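/- Let $\mathbb{D}=\{z\in\mathbb{C}:|z|<1\}$. The Bloch space $\mathcal{B}$ consists of the holomorphic functions $b$ on $\mathbb{D}$ with $\|b\|_{\mathcal{B}}:=\sup_{z\in\mathbb{D}}(1-|z|^2)|b'(z)|<\infty$, and the little Bloch space $\mathcal{B}_0\subset\mathcal{B}$ of those $b_0$ with $\lim_{|z|\to1^-}(1-|z|^2)|b_0'(z)|=0$. For $\mu\in L^\infty(\mathbb{D})$ (complex-valued) the Bergman projection is $$P\mu(z)=\frac1\pi\int_{\mathbb{D}}\frac{\mu(w)}{(1-z\overline{w})^2}\,|dw|^2,\qquad z\in\mathbb{D},$$ where $|dw|^2$ denotes Lebesgue area measure. Then $P\mu\in\mathcal{B}$ for every $\mu\in L^\infty(\mathbb{D})$, and the induced linear map $P:L^\infty(\mathbb{D})\to\mathcal{B}/\mathcal{B}_0$ is surjective. Moreover, there is a constant $C\ge 0$ such that every $b\in\mathcal{B}$ can be represented as $$b=P\mu+b_0,\qquad \mu\in L^\infty(\mathbb{D}),\quad \|\mu\|_\infty\le C\,\|b\|_{\mathcal{B}},\quad b_0\in\mathcal{B}_0,$$ where $C$ does not depend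 on $b$. Furthermore, the optimal constant, i.e. the infimum of all $C\ge 0$ with this property, is strictly less than $1$. -/

import Mathlib

open Filter Topology MeasureTheory

noncomputable section

/-- The open unit disk in the complex plane. -/
abbrev disk : Set ℂ := Metric.ball (0 : ℂ) 1

/-- The Bloch quotient `(1 - |z|²) |b'(z)|`. -/
def blochQuotient (b : ℂ → ℂ) (z : ℂ) : ℝ := (1 - ‖z‖ ^ 2) * ‖deriv b z‖

theorem blochQuotient_nonneg (b : ℂ → ℂ) {z : ℂ} (hz : z ∈ disk) : 0 ≤ blochQuotient b z := by
  have h1 : ‖z‖ < 1 := by simpa using hz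
  have h2 : 0 ≤ ‖z‖ := norm_nonneg z
  exact mul_nonneg (by nlinarith) (norm_nonneg _)

theorem blochQuotient_add_le {f g : ℂ → ℂ} (hf : DifferentiableOn ℂ f disk)
    (hg : DifferentiableOn ℂ g disk) {z : ℂ} (hz : z ∈ disk) :
    blochQuotient (f + g) z ≤ blochQuotient f z + blochQuotient g z := by
  have hU : disk ∈ 𝓝 z := Metric.isOpen_ball.mem_nhds hz
  have h1 : ‖z‖ < 1 := by simpa using hz
  have h2 : 0 ≤ ‖z‖ := norm_nonneg z
  unfold blochQuotient
  rw [deriv_add (hf.differentiableAt hU) (hg.differentiableAt hU), ← mul_add]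
  exact mul_le_mul_of_nonneg_left (norm_add_le _ _) (by nlinarith)

theorem blochQuotient_smul (c : ℂ) (f : ℂ → ℂ) (z : ℂ) :
    blochQuotient (c • f) z = ‖c‖ * blochQuotient f z := by
  unfold blochQuotient
  rw [deriv_const_smul_field, norm_smul]
  ring

/-- The Bloch space `𝓑`: functions that are holomorphic in the unit disk and satisfy
`sup_{|z| < 1} (1 - |z|²) |b'(z)| < ∞`. Elements are represented by functions `ℂ → ℂ`, whose
values off the disk play no role. -/
def blochSpace : Submodule ℂ (ℂ → ℂ) where
  carrier := {b | DifferentiableOn ℂ b disk ∧ BddAbove (blochQuotient b '' disk)}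
  add_mem' := by
    rintro f g ⟨hf, M, hM⟩ ⟨hg, N, hN⟩
    refine ⟨hf.add hg, M + N, ?_⟩
    rintro _ ⟨z, hz, rfl⟩
    exact (blochQuotient_add_le hf hg hz).trans
      (add_le_add (hM ⟨z, hz, rfl⟩) (hN ⟨z, hz, rfl⟩))
  zero_mem' := by
    refine ⟨differentiableOn_const (0 : ℂ), 0, ?_⟩
    rintro _ ⟨z, _, rfl⟩
    have h := blochQuotient_smul 0 0 z
    rw [smul_zero, norm_zero, zero_mul] at h
    exact h.le
  smul_mem' := by
    rintro c f ⟨hf, M, hM⟩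
    refine ⟨hf.const_smul c, ‖c‖ * M, ?_⟩
    rintro _ ⟨z, hz, rfl⟩
    rw [blochQuotient_smul]
    exact mul_le_mul_of_nonneg_left (hM ⟨z, hz, rfl⟩) (norm_nonneg c)

/-- The Bloch (semi)norm `‖b‖_𝓑 = sup_{|z| < 1} (1 - |z|²) |b'(z)|`. The supremum is over a
nonempty set, which is bounded above for every `b` in the Bloch space. -/
def blochNorm (b : blochSpace) : ℝ := sSup (blochQuotient (b : ℂ → ℂ) '' disk)

/-- The little Bloch space `𝓑₀ ⊆ 𝓑`: those `b` for which `(1 - |z|²) |b'(z)| → 0` as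
`|z| → 1⁻`. -/
def littleBlochSpace : Submodule ℂ blochSpace where
  carrier := {b | Tendsto (blochQuotient (b : ℂ → ℂ)) (comap (fun z : ℂ => ‖z‖) (𝓝[<] 1)) (𝓝 0)}
  add_mem' := by
    intro f g hf hg
    have hev : ∀ᶠ z : ℂ in comap (fun z : ℂ => ‖z‖) (𝓝[<] 1), z ∈ disk := by
      have h : ∀ᶠ r : ℝ in 𝓝[<] 1, r < 1 := self_mem_nhdsWithin
      filter_upwards [h.comap (fun z : ℂ => ‖z‖)] with z hz
      simpa using hz
    have hsum := Tendsto.add hf hg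
    rw [add_zero] at hsum
    refine tendsto_of_tendsto_of_tendsto_of_le_of_le' tendsto_const_nhds hsum ?_ ?_
    · filter_upwards [hev] with z hz using blochQuotient_nonneg _ hz
    · filter_upwards [hev] with z hz using blochQuotient_add_le f.2.1 g.2.1 hz
  zero_mem' := by
    have h : blochQuotient ((0 : blochSpace) : ℂ → ℂ) = fun _ => 0 := by
      funext z
      have h := blochQuotient_smul 0 0 z
      rwa [smul_zero, norm_zero, zero_mul] at h
    simp only [Set.mem_ofPred_eq, h]
    exact tendsto_const_nhds
  smul_mem' := by
    intro c f hf
    have h : blochQuotient ((c • f : blochSpace) : ℂ → ℂ)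
        = fun z => ‖c‖ * blochQuotient (f : ℂ → ℂ) z := by
      funext z
      exact blochQuotient_smul c f z
    simp only [Set.mem_ofPred_eq, h]
    have h2 := Tendsto.const_mul ‖c‖ hf
    rwa [mul_zero] at h2

/-- `L^∞(𝔻)`, complex valued, with respect to Lebesgue measure; its norm is the essential
supremum. -/
abbrev LInftyDisk : Type := Lp ℂ ⊤ (volume.restrict disk)

/-- The Bergman projection `Pμ(z) = (1/π) ∫_𝔻 μ(w) / (1 - z w̄)² |dw|²`. -/
def bergmanProj (μ : LInftyDisk) (z : ℂ) : ℂ :=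
  (1 / (Real.pi : ℂ)) * ∫ w in disk, μ w / (1 - z * (starRingEnd ℂ) w) ^ 2

/-- `C ≥ 0` is an admissible constant if every Bloch function `b` can be written on the disk as
`b = Pμ + b₀` with `b₀ ∈ 𝓑₀` and `‖μ‖_∞ ≤ C ‖b‖_𝓑`. -/
def IsAdmissibleConstant (C : ℝ) : Prop :=
  0 ≤ C ∧ ∀ b : blochSpace, ∃ μ : LInftyDisk, ∃ b₀ ∈ littleBlochSpace,
    (∀ z ∈ disk, (b : ℂ → ℂ) z = bergmanProj μ z + (b₀ : ℂ → ℂ) z) ∧ ‖μ‖ ≤ C * blochNorm b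

end

/-!
Let `b` be a Bloch function with `‖b‖_𝓑 = 1`. Put `f = b'` and `A(w) = (1 - |w|²) f(w)`, so that
`|A| ≤ 1`. Then `(Pμ)'(z) = (2/π) ∫ μ(w) w̄ (1 - z w̄)⁻³ |dw|²` (`hasDerivAt_bergmanProj`), while the
reproducing formula `setIntegral_reproducing` says `f(z) = (2/π) ∫ A(w) (1 - z w̄)⁻³ |dw|²`. Hence
`μ = A / w̄` restricted to `|w| > ρ` gives `b - Pμ` a bounded derivative, which puts `b - Pμ` into the
little Bloch space. As `ρ → 1` this shows that every constant larger than `1` is admissible.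

To get below `1`, the density `A` is replaced by some `ν` with `|ν| ≤ c < 1` that has the same
integrals against conjugates of bounded holomorphic functions (`exists_density_le_const_lt_one`).
Write `φ_z` for the involution of the disk exchanging `0` and `z`, and `F = (f ∘ φ_z) φ_z'`. If
`|A(z)| ≥ 1/2`, then `F` has no zeros in a small disk `|x| < r`, and the mean value property of
`G / F³`, with `G = (g ∘ φ_z) (φ_z')²`, expresses `A(z)` times the conjugate of `g(z)` as an integral
of the conjugate of `g` over the pseudohyperbolic disk about `z` (`setIntegral_sweepKernel`). So the
mass at `z` may be spread over that disk, with a density proportional to `|F(0)|⁴ / |F(x)|³`. By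
`|F(x)| = |A(φ_z(x))| / (1 - |x|²)`, the total mass arriving at `w` is at most
`|A(w)|⁻³ (1 - r²/2)` (`lintegral_sweepWeight`, `lintegral_cutKernel_le`). At points where `|A(w)|` is
close to `1` less arrives than leaves; at the other points `|A|` is bounded away from `1`, and
sweeping only a small proportion of the mass keeps `|ν|` below `1`.

The same change of variables `w = φ_z(x)` gives `∫ |1 - z̄ w|⁻³ |dw|² ≤ C / (1 - |z|²)`, which is the
boundedness of `P : L^∞ → 𝓑` (`bergmanProj_mem_blochSpace`).
-/

noncomputable section

/-! ### Möbius automorphisms of the disk -/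

/-- The involutive automorphism `φ_z(w) = (z - w) / (1 - z̄ w)` of the disk, exchanging `0` and
`z`. -/
def mob (z w : ℂ) : ℂ := (z - w) / (1 - (starRingEnd ℂ) z * w)

theorem mem_disk {z : ℂ} : z ∈ disk ↔ ‖z‖ < 1 := by simp

theorem one_sub_sq_pos {z : ℂ} (hz : z ∈ disk) : 0 < 1 - ‖z‖ ^ 2 := by
  have h := mem_disk.1 hz
  nlinarith [norm_nonneg z]

theorem one_sub_conj_mul_ne_zero {z w : ℂ} (hz : z ∈ disk) (hw : ‖w‖ ≤ 1) :
    1 - (starRingEnd ℂ) z * w ≠ 0 := by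
  intro h
  have h1 : (starRingEnd ℂ) z * w = 1 := (sub_eq_zero.1 h).symm
  have h2 := congrArg norm h1
  rw [norm_mul, RCLike.norm_conj, norm_one] at h2
  have := mem_disk.1 hz
  nlinarith [norm_nonneg z, norm_nonneg w]

theorem norm_one_sub_conj_mul_comm (z w : ℂ) :
    ‖1 - (starRingEnd ℂ) z * w‖ = ‖1 - (starRingEnd ℂ) w * z‖ := by
  rw [← RCLike.norm_conj (1 - (starRingEnd ℂ) z * w)]
  simp [mul_comm]

theorem norm_one_sub_mul_conj (z w : ℂ) :
    ‖1 - z * (starRingEnd ℂ) w‖ = ‖1 - (starRingEnd ℂ) z * w‖ := by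
  rw [← RCLike.norm_conj (1 - (starRingEnd ℂ) z * w)]
  simp

theorem norm_mob_comm (z w : ℂ) : ‖mob z w‖ = ‖mob w z‖ := by
  rw [mob, mob, norm_div, norm_div, norm_one_sub_conj_mul_comm, norm_sub_rev]

theorem one_sub_norm_mob_sq {z w : ℂ} (hz : z ∈ disk) (hw : ‖w‖ ≤ 1) :
    1 - ‖mob z w‖ ^ 2
      = (1 - ‖z‖ ^ 2) * (1 - ‖w‖ ^ 2) / ‖1 - (starRingEnd ℂ) z * w‖ ^ 2 := by
  have h := norm_ne_zero_iff.2 (one_sub_conj_mul_ne_zero hz hw)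
  rw [mob, norm_div, div_pow, eq_div_iff (pow_ne_zero 2 h), sub_mul,
    div_mul_cancel₀ _ (pow_ne_zero 2 h)]
  simp only [← Complex.normSq_eq_norm_sq, Complex.normSq_apply]
  simp
  ring

theorem mob_mem_disk {z w : ℂ} (hz : z ∈ disk) (hw : w ∈ disk) : mob z w ∈ disk := by
  have hw' := mem_disk.1 hw
  have h := one_sub_norm_mob_sq hz hw'.le
  have h1 : 0 < 1 - ‖mob z w‖ ^ 2 := by
    rw [h]
    have := norm_pos_iff.2 (one_sub_conj_mul_ne_zero hz hw'.le)
    have := one_sub_sq_pos hz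
    have := one_sub_sq_pos hw
    positivity
  rw [mem_disk]
  nlinarith [norm_nonneg (mob z w)]

theorem conj_mul_self_eq (z : ℂ) : (starRingEnd ℂ) z * z = ((‖z‖ ^ 2 : ℝ) : ℂ) := by
  rw [Complex.conj_mul']; push_cast; rfl

theorem one_sub_conj_mul_mob {z w : ℂ} (hz : z ∈ disk) (hw : ‖w‖ ≤ 1) :
    1 - (starRingEnd ℂ) z * mob z w
      = ((1 - ‖z‖ ^ 2 : ℝ) : ℂ) / (1 - (starRingEnd ℂ) z * w) := by
  have h := one_sub_conj_mul_ne_zero hz hw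
  rw [mob, eq_div_iff h, Complex.ofReal_sub, ← conj_mul_self_eq]
  field_simp
  push_cast
  ring

theorem mob_mob {z w : ℂ} (hz : z ∈ disk) (hw : w ∈ disk) : mob z (mob z w) = w := by
  have hw' := (mem_disk.1 hw).le
  have h := one_sub_conj_mul_ne_zero hz hw'
  have h2 : ((1 - ‖z‖ ^ 2 : ℝ) : ℂ) ≠ 0 := by
    exact_mod_cast (one_sub_sq_pos hz).ne'
  rw [mob, one_sub_conj_mul_mob hz hw', div_div_eq_mul_div, div_eq_iff h2, mob,
    Complex.ofReal_sub, ← conj_mul_self_eq, sub_mul z, div_mul_cancel₀ _ h]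
  push_cast
  ring

theorem mob_zero_right (z : ℂ) : mob z 0 = z := by simp [mob]

theorem hasDerivAt_mob {z w : ℂ} (hz : z ∈ disk) (hw : w ∈ disk) :
    HasDerivAt (mob z) (-((1 - ‖z‖ ^ 2 : ℝ) : ℂ) / (1 - (starRingEnd ℂ) z * w) ^ 2) w := by
  have h := one_sub_conj_mul_ne_zero hz (mem_disk.1 hw).le
  have h1 : HasDerivAt (fun w : ℂ => z - w) (-1) w := (hasDerivAt_id w).const_sub z
  have h2 : HasDerivAt (fun w : ℂ => 1 - (starRingEnd ℂ) z * w) (-((starRingEnd ℂ) z * 1)) w :=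
    ((hasDerivAt_id w).const_mul _).const_sub 1
  convert! h1.div h2 h using 1
  rw [Complex.ofReal_sub, ← conj_mul_self_eq]
  push_cast
  ring

/-- The Jacobian of `φ_z` at `w`. -/
def mobJac (z w : ℂ) : ℝ := ((1 - ‖z‖ ^ 2) / ‖1 - (starRingEnd ℂ) z * w‖ ^ 2) ^ 2

theorem mobJac_nonneg (z w : ℂ) : 0 ≤ mobJac z w := sq_nonneg _

/-- The pseudohyperbolic disk of center `z` and radius `r`. -/
def pseudoBall (z : ℂ) (r : ℝ) : Set ℂ := {w | w ∈ disk ∧ ‖mob z w‖ < r}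

theorem ball_subset_disk {r : ℝ} (hr : r ≤ 1) : Metric.ball (0 : ℂ) r ⊆ disk :=
  Metric.ball_subset_ball hr

theorem mob_image_ball {z : ℂ} (hz : z ∈ disk) {r : ℝ} (hr : r ≤ 1) :
    mob z '' Metric.ball 0 r = pseudoBall z r := by
  ext w
  constructor
  · rintro ⟨x, hx, rfl⟩
    have hx' := ball_subset_disk hr hx
    refine ⟨mob_mem_disk hz hx', ?_⟩
    rw [mob_mob hz hx']
    simpa using hx
  · rintro ⟨hw, h⟩
    exact ⟨mob z w, by simpa using h, mob_mob hz hw⟩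

theorem pseudoBall_one {z : ℂ} (hz : z ∈ disk) : pseudoBall z 1 = disk := by
  ext w
  exact ⟨fun h => h.1, fun h => ⟨h, mem_disk.1 (mob_mem_disk hz h)⟩⟩

theorem mob_injOn {z : ℂ} (hz : z ∈ disk) : Set.InjOn (mob z) disk := by
  intro x hx y hy h
  rw [← mob_mob hz hx, h, mob_mob hz hy]

theorem abs_det_toSpanSingleton (c : ℂ) :
    |((ContinuousLinearMap.toSpanSingleton ℂ c).restrictScalars ℝ).det| = ‖c‖ ^ 2 := by
  have : (((ContinuousLinearMap.toSpanSingleton ℂ c).restrictScalars ℝ : ℂ →L[ℝ] ℂ) : ℂ →ₗ[ℝ] ℂ)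
      = LinearMap.mul ℝ ℂ c := by
    ext; simp [mul_comm]
  rw [ContinuousLinearMap.det, this, ← LinearMap.det_toMatrix Complex.basisOneI,
    Matrix.det_fin_two]
  simp [LinearMap.toMatrix_apply, ← Complex.normSq_eq_norm_sq, Complex.normSq_apply]
  exact add_nonneg (mul_self_nonneg _) (mul_self_nonneg _)

theorem norm_sq_deriv_mob {z : ℂ} (hz : z ∈ disk) (w : ℂ) :
    ‖-((1 - ‖z‖ ^ 2 : ℝ) : ℂ) / (1 - (starRingEnd ℂ) z * w) ^ 2‖ ^ 2 = mobJac z w := by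
  rw [norm_div, norm_neg, norm_pow, Complex.norm_real, Real.norm_of_nonneg (one_sub_sq_pos hz).le,
    mobJac]

theorem hasFDerivWithinAt_mob {z w : ℂ} (hz : z ∈ disk) (hw : w ∈ disk) (s : Set ℂ) :
    HasFDerivWithinAt (mob z) ((ContinuousLinearMap.toSpanSingleton ℂ
      (-((1 - ‖z‖ ^ 2 : ℝ) : ℂ) / (1 - (starRingEnd ℂ) z * w) ^ 2)).restrictScalars ℝ) s w :=
  ((hasDerivAt_mob hz hw).hasFDerivAt.restrictScalars ℝ).hasFDerivWithinAt

/-- The substitution `w = φ_z(x)`. -/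
theorem setIntegral_pseudoBall {z : ℂ} (hz : z ∈ disk) {r : ℝ} (hr : r ≤ 1) (h : ℂ → ℂ) :
    ∫ w in pseudoBall z r, h w
      = ∫ x in Metric.ball (0 : ℂ) r, (mobJac z x : ℂ) * h (mob z x) := by
  rw [← mob_image_ball hz hr, integral_image_eq_integral_abs_det_fderiv_smul volume
    measurableSet_ball (fun x hx => hasFDerivWithinAt_mob hz (ball_subset_disk hr hx) _)
    ((mob_injOn hz).mono (ball_subset_disk hr))]
  simp only [abs_det_toSpanSingleton, norm_sq_deriv_mob hz, Complex.real_smul]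

theorem setLIntegral_pseudoBall {z : ℂ} (hz : z ∈ disk) {r : ℝ} (hr : r ≤ 1) (h : ℂ → ENNReal) :
    ∫⁻ w in pseudoBall z r, h w
      = ∫⁻ x in Metric.ball (0 : ℂ) r, ENNReal.ofReal (mobJac z x) * h (mob z x) := by
  rw [← mob_image_ball hz hr, lintegral_image_eq_lintegral_abs_det_fderiv_mul volume
    measurableSet_ball (fun x hx => hasFDerivWithinAt_mob hz (ball_subset_disk hr hx) _)
    ((mob_injOn hz).mono (ball_subset_disk hr))]
  simp only [abs_det_toSpanSingleton, norm_sq_deriv_mob hz]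

theorem measurable_mob_uncurry : Measurable (fun p : ℂ × ℂ => mob p.1 p.2) := by
  unfold mob
  fun_prop

theorem measurableSet_pseudoBall (z : ℂ) (r : ℝ) : MeasurableSet (pseudoBall z r) := by
  have h : Measurable (mob z) := measurable_mob_uncurry.comp measurable_prodMk_left
  exact measurableSet_ball.inter (measurableSet_lt h.norm measurable_const)

/-! ### Mean values and the reproducing formula -/

theorem integral_comp_rotation (a : Circle) (R : ℝ) (g : ℂ → ℂ) :
    ∫ x in Metric.ball (0 : ℂ) R, g (a * x) = ∫ x in Metric.ball (0 : ℂ) R, g x := by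
  have h := (rotation a).measurePreserving.setIntegral_preimage_emb
    (rotation a).toHomeomorph.measurableEmbedding g (Metric.ball (0 : ℂ) R)
  have h2 : (rotation a) ⁻¹' Metric.ball (0 : ℂ) R = Metric.ball (0 : ℂ) R := by
    ext x; simp only [Set.mem_preimage, mem_ball_zero_iff, LinearIsometryEquiv.norm_map]
  rw [h2] at h
  simpa using h

/-- The mean value property over a disk with a radial weight, obtained by averaging over all
rotations. -/
theorem setIntegral_ball_radial_mul {R C : ℝ} {κ : ℝ → ℂ} (hκ : Measurable κ) {h : ℂ → ℂ}
    (hh : DifferentiableOn ℂ h (Metric.ball 0 R))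
    (hC : ∀ x ∈ Metric.ball (0 : ℂ) R, ‖κ ‖x‖ * h x‖ ≤ C) :
    ∫ x in Metric.ball (0 : ℂ) R, κ ‖x‖ * h x
      = (∫ x in Metric.ball (0 : ℂ) R, κ ‖x‖) * h 0 := by
  set B := Metric.ball (0 : ℂ) R with hB
  -- rotation invariance of the integral, for each angle `t`
  have hrot : ∀ t : ℝ, ∫ x in B, κ ‖x‖ * h (circleMap 0 1 t * x) = ∫ x in B, κ ‖x‖ * h x := by
    intro t
    have := integral_comp_rotation (Circle.exp t) R (fun x => κ ‖x‖ * h x)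
    simpa [circleMap, Circle.coe_exp] using this
  -- the mean value property of `h` on the circle through `x`
  have hmean : ∀ x ∈ B, ∫ t in (0 : ℝ)..2 * Real.pi, h (circleMap 0 1 t * x)
      = 2 * Real.pi * h 0 := by
    intro x hx
    have hx' : ‖x‖ < R := by simpa [hB] using hx
    have hd : DifferentiableOn ℂ (fun y => h (y * x)) (Metric.closedBall 0 1) := by
      refine hh.comp (by fun_prop) ?_
      intro y hy
      have hy' : ‖y‖ ≤ 1 := by simpa using hy
      have : ‖y * x‖ < R := by
        rw [norm_mul]; nlinarith [norm_nonneg x]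
      simpa [hB] using this
    have hdc : DiffContOnCl ℂ (fun y => h (y * x)) (Metric.ball 0 |(1 : ℝ)|) := by
      rw [abs_one]
      exact DifferentiableOn.diffContOnCl (hd.mono Metric.closure_ball_subset_closedBall)
    have := hdc.circleAverage
    rw [Real.circleAverage_def, inv_smul_eq_iff₀ (by positivity)] at this
    simpa using this
  have hmaps : ∀ p : ℝ × ℂ, p.2 ∈ B → circleMap 0 1 p.1 * p.2 ∈ B := by
    rintro ⟨t, x⟩ hx
    simpa [hB] using hx
  have hint : Integrable (Function.uncurry fun (t : ℝ) (x : ℂ) => κ ‖x‖ * h (circleMap 0 1 t * x))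
      ((volume.restrict (Set.uIoc 0 (2 * Real.pi))).prod (volume.restrict B)) := by
    rw [Measure.prod_restrict]
    have hms : MeasurableSet (Set.uIoc 0 (2 * Real.pi) ×ˢ B) :=
      measurableSet_uIoc.prod measurableSet_ball
    refine IntegrableOn.of_bound (C := C) ?_ ?_ ?_
    · rw [Measure.prod_prod]
      refine ENNReal.mul_lt_top ?_ measure_ball_lt_top
      rw [Set.uIoc_of_le Real.two_pi_pos.le]
      exact measure_Ioc_lt_top
    · refine AEStronglyMeasurable.mul ?_ ?_
      · exact (hκ.comp measurable_snd.norm).aestronglyMeasurable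
      · refine ContinuousOn.aestronglyMeasurable ?_ hms
        refine hh.continuousOn.comp (by fun_prop) ?_
        intro p hp
        exact hmaps p hp.2
    · filter_upwards [ae_restrict_mem hms] with p hp
      have := hC _ (hmaps p hp.2)
      simpa [Function.uncurry] using this
  have hswap := intervalIntegral_integral_swap (E := ℂ) hint
  simp only [hrot] at hswap
  rw [intervalIntegral.integral_const] at hswap
  have h3 : ∫ x in B, ∫ t in (0 : ℝ)..2 * Real.pi, κ ‖x‖ * h (circleMap 0 1 t * x)
      = (2 * Real.pi) * ((∫ x in B, κ ‖x‖) * h 0) := by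
    rw [← integral_mul_const, ← integral_const_mul]
    refine setIntegral_congr_fun measurableSet_ball fun x hx => ?_
    rw [intervalIntegral.integral_const_mul, hmean x hx]
    ring
  rw [h3] at hswap
  have hpi : (2 * Real.pi : ℂ) ≠ 0 := by
    exact_mod_cast (by positivity : (2 * Real.pi : ℝ) ≠ 0)
  refine mul_left_cancel₀ hpi ?_
  rw [← hswap]
  simp

theorem integral_ball_one_sub_sq {R : ℝ} (hR : 0 ≤ R) :
    ∫ x in Metric.ball (0 : ℂ) R, (1 - ‖x‖ ^ 2) = Real.pi * (R ^ 2 - R ^ 4 / 2) := by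
  have h := integral_fun_norm_addHaar (volume : Measure ℂ)
    (Set.indicator (Set.Iio R) (fun y : ℝ => 1 - y ^ 2))
  have h1 : ∀ x : ℂ, Set.indicator (Set.Iio R) (fun y : ℝ => 1 - y ^ 2) ‖x‖
      = (Metric.ball (0 : ℂ) R).indicator (fun x => 1 - ‖x‖ ^ 2) x := by
    intro x
    by_cases hx : ‖x‖ < R
    · rw [Set.indicator_of_mem (by simpa using hx), Set.indicator_of_mem (by simpa using hx)]
    · rw [Set.indicator_of_notMem (by simpa using hx), Set.indicator_of_notMem (by simpa using hx)]
  simp only [h1] at h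
  rw [integral_indicator measurableSet_ball] at h
  rw [h]
  have h2 : ∀ y : ℝ, y ^ (Module.finrank ℝ ℂ - 1) • Set.indicator (Set.Iio R)
      (fun y : ℝ => 1 - y ^ 2) y = Set.indicator (Set.Iio R) (fun y : ℝ => y - y ^ 3) y := by
    intro y
    rw [Complex.finrank_real_complex]
    by_cases hy : y < R
    · simp [hy]; ring
    · simp [hy]
  simp only [h2]
  rw [setIntegral_indicator measurableSet_Iio, Set.Ioi_inter_Iio, ← integral_Ioc_eq_integral_Ioo,
    ← intervalIntegral.integral_of_le hR, intervalIntegral.integral_sub (by simp) (by simp)]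
  simp [Measure.real, Complex.volume_ball]
  ring


theorem one_sub_norm_le_norm_one_sub {z w : ℂ} (hw : ‖w‖ ≤ 1) :
    1 - ‖z‖ ≤ ‖1 - (starRingEnd ℂ) z * w‖ := by
  have h := norm_sub_norm_le (1 : ℂ) ((starRingEnd ℂ) z * w)
  rw [norm_one, norm_mul, RCLike.norm_conj] at h
  nlinarith [norm_nonneg z, norm_nonneg w]

theorem differentiableOn_mob {z : ℂ} (hz : z ∈ disk) : DifferentiableOn ℂ (mob z) disk :=
  fun _ hw => (hasDerivAt_mob hz hw).differentiableAt.differentiableWithinAt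

theorem differentiableOn_comp_mob {z : ℂ} (hz : z ∈ disk) {f : ℂ → ℂ}
    (hf : DifferentiableOn ℂ f disk) : DifferentiableOn ℂ (fun x => f (mob z x)) disk :=
  hf.comp (differentiableOn_mob hz) fun _ hx => mob_mem_disk hz hx

theorem one_sub_mul_conj_mob {z x : ℂ} (hz : z ∈ disk) (hx : ‖x‖ ≤ 1) :
    1 - z * (starRingEnd ℂ) (mob z x)
      = ((1 - ‖z‖ ^ 2 : ℝ) : ℂ) / (1 - z * (starRingEnd ℂ) x) := by
  have h := congrArg (starRingEnd ℂ) (one_sub_conj_mul_mob hz hx)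
  simpa using h

theorem conj_one_sub (z x : ℂ) :
    (starRingEnd ℂ) (1 - (starRingEnd ℂ) z * x) = 1 - z * (starRingEnd ℂ) x := by simp

/-- The reproducing formula of the weighted Bergman space with weight `1 - |w|²`: the substitution
`w = φ_z(x)` reduces it to the mean value property at `x = 0`. -/
theorem setIntegral_reproducing {f : ℂ → ℂ} (hf : DifferentiableOn ℂ f disk) {M : ℝ}
    (hM : ∀ w ∈ disk, (1 - ‖w‖ ^ 2) * ‖f w‖ ≤ M) {z : ℂ} (hz : z ∈ disk) :
    ∫ w in disk, ((1 - ‖w‖ ^ 2 : ℝ) : ℂ) * f w * (1 / (1 - z * (starRingEnd ℂ) w) ^ 3)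
      = Real.pi / 2 * f z := by
  have hz1 := one_sub_sq_pos hz
  have hz2 := mem_disk.1 hz
  have key : ∀ x ∈ disk, (mobJac z x : ℂ) * (((1 - ‖mob z x‖ ^ 2 : ℝ) : ℂ) * f (mob z x) *
      (1 / (1 - z * (starRingEnd ℂ) (mob z x)) ^ 3))
      = ((1 - ‖x‖ ^ 2 : ℝ) : ℂ) * (f (mob z x) / (1 - (starRingEnd ℂ) z * x) ^ 3) := by
    intro x hx
    have hx' := (mem_disk.1 hx).le
    have hd := one_sub_conj_mul_ne_zero hz hx'
    have hd' : 1 - z * (starRingEnd ℂ) x ≠ 0 := by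
      rw [← conj_one_sub]; exact (map_ne_zero _).2 hd
    have hz3 : ((1 - ‖z‖ ^ 2 : ℝ) : ℂ) ≠ 0 := by exact_mod_cast hz1.ne'
    have hn : ((‖1 - (starRingEnd ℂ) z * x‖ ^ 2 : ℝ) : ℂ)
        = (1 - (starRingEnd ℂ) z * x) * (1 - z * (starRingEnd ℂ) x) := by
      rw [← conj_one_sub, Complex.mul_conj, Complex.normSq_eq_norm_sq]
    rw [one_sub_mul_conj_mob hz hx', one_sub_norm_mob_sq hz hx', mobJac, Complex.ofReal_pow,
      Complex.ofReal_div, Complex.ofReal_div, Complex.ofReal_mul, hn]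
    field_simp
  have h0 := setIntegral_pseudoBall hz le_rfl
    (fun w => ((1 - ‖w‖ ^ 2 : ℝ) : ℂ) * f w * (1 / (1 - z * (starRingEnd ℂ) w) ^ 3))
  rw [pseudoBall_one hz] at h0
  rw [h0, setIntegral_congr_fun measurableSet_ball key]
  have hdiff : DifferentiableOn ℂ (fun x => f (mob z x) / (1 - (starRingEnd ℂ) z * x) ^ 3) disk := by
    refine (differentiableOn_comp_mob hz hf).div (by fun_prop) ?_
    intro x hx
    exact pow_ne_zero 3 (one_sub_conj_mul_ne_zero hz (mem_disk.1 hx).le)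
  rw [setIntegral_ball_radial_mul (κ := fun t => ((1 - t ^ 2 : ℝ) : ℂ))
    (C := M / ((1 - ‖z‖ ^ 2) * (1 - ‖z‖))) (by fun_prop) hdiff]
  · rw [integral_complex_ofReal, integral_ball_one_sub_sq zero_le_one]
    simp only [mob_zero_right, mul_zero, sub_zero, one_pow, div_one]
    push_cast
    ring
  · intro x hx
    have hx' := (mem_disk.1 hx).le
    have hd := norm_pos_iff.2 (one_sub_conj_mul_ne_zero hz hx')
    have h1 := hM _ (mob_mem_disk hz hx)
    have h2 := one_sub_norm_le_norm_one_sub (z := z) hx'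
    have h3 : 0 < 1 - ‖z‖ := by linarith
    have hx1 := one_sub_sq_pos hx
    rw [one_sub_norm_mob_sq hz hx'] at h1
    rw [norm_mul, norm_div, norm_pow, Complex.norm_real, Real.norm_of_nonneg hx1.le]
    set d := ‖1 - (starRingEnd ℂ) z * x‖ with hd_def
    have hM0 : 0 ≤ M := le_trans (by positivity) h1
    calc (1 - ‖x‖ ^ 2) * (‖f (mob z x)‖ / d ^ 3)
        = ((1 - ‖z‖ ^ 2) * (1 - ‖x‖ ^ 2) / d ^ 2 * ‖f (mob z x)‖) / ((1 - ‖z‖ ^ 2) * d) := by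
          field_simp
      _ ≤ M / ((1 - ‖z‖ ^ 2) * (1 - ‖z‖)) := by gcongr

/-! ### The Bergman projection maps into the Bloch space -/

theorem lintegral_ball_inv_norm_lt_top (R : ℝ) :
    ∫⁻ y in Metric.ball (0 : ℂ) R, ENNReal.ofReal (2 / ‖y‖) < ⊤ := by
  have h := integrable_fun_norm_addHaar (volume : Measure ℂ)
    (f := Set.indicator (Set.Iio R) (fun y : ℝ => 2 / y))
  have h1 : ∀ x : ℂ, Set.indicator (Set.Iio R) (fun y : ℝ => 2 / y) ‖x‖
      = (Metric.ball (0 : ℂ) R).indicator (fun x => 2 / ‖x‖) x := by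
    intro x
    by_cases hx : ‖x‖ < R
    · rw [Set.indicator_of_mem (by simpa using hx), Set.indicator_of_mem (by simpa using hx)]
    · rw [Set.indicator_of_notMem (by simpa using hx), Set.indicator_of_notMem (by simpa using hx)]
  simp only [h1] at h
  rw [integrable_indicator_iff measurableSet_ball] at h
  have h2 : IntegrableOn (Set.indicator (Set.Iio R) (fun _ : ℝ => (2 : ℝ))) (Set.Ioi 0) := by
    rw [IntegrableOn, integrable_indicator_iff measurableSet_Iio, IntegrableOn,
      Measure.restrict_restrict measurableSet_Iio, Set.Iio_inter_Ioi]
    exact integrableOn_const (by simp)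
  have h3 : IntegrableOn (fun y : ℝ => y ^ (Module.finrank ℝ ℂ - 1) •
      Set.indicator (Set.Iio R) (fun y : ℝ => 2 / y) y) (Set.Ioi 0) := by
    refine h2.congr_fun (fun y hy => ?_) measurableSet_Ioi
    have hy' : y ≠ 0 := ne_of_gt hy
    rw [Complex.finrank_real_complex]
    by_cases hyR : y < R
    · simp [hyR]; field_simp
    · simp [hyR]
  have h4 := (h.2 h3).lintegral_lt_top
  exact h4

/-- `∫_𝔻 |1 - z̄ x|⁻¹ |dx|²` is bounded uniformly in `z`: with `u = z / |z|` the integrand is at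
most `2 / |u - x|`. -/
theorem lintegral_inv_norm_one_sub_le {z : ℂ} (hz : z ∈ disk) :
    ∫⁻ x in disk, ENNReal.ofReal (1 / ‖1 - (starRingEnd ℂ) z * x‖)
      ≤ ∫⁻ y in Metric.ball (0 : ℂ) 2, ENNReal.ofReal (2 / ‖y‖) := by
  obtain ⟨u, hu, hzu⟩ : ∃ u : ℂ, ‖u‖ = 1 ∧ z = ‖z‖ * u := by
    rcases eq_or_ne z 0 with rfl | h0
    · exact ⟨1, by simp, by simp⟩
    · have : (‖z‖ : ℂ) ≠ 0 := by simpa using h0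
      exact ⟨z / ‖z‖, by simp [h0], by field_simp⟩
  have hz' := mem_disk.1 hz
  have key : ∀ x ∈ disk, ENNReal.ofReal (1 / ‖1 - (starRingEnd ℂ) z * x‖)
      ≤ (Metric.ball (0 : ℂ) 2).indicator (fun y => ENNReal.ofReal (2 / ‖y‖)) (u - x) := by
    intro x hx
    have hx' := mem_disk.1 hx
    have hmem : u - x ∈ Metric.ball (0 : ℂ) 2 := by
      have := norm_sub_le u x
      simp only [mem_ball_zero_iff]
      linarith
    rw [Set.indicator_of_mem hmem]
    apply ENNReal.ofReal_le_ofReal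
    have hpos : 0 < ‖u - x‖ := by
      have := norm_sub_norm_le u x
      linarith
    have hd := norm_pos_iff.2 (one_sub_conj_mul_ne_zero hz hx'.le)
    have h1 : ‖u - x‖ = ‖1 - (starRingEnd ℂ) u * x‖ := by
      have : u - x = u * (1 - (starRingEnd ℂ) u * x) := by
        rw [mul_sub, ← mul_assoc, Complex.mul_conj, Complex.normSq_eq_norm_sq, hu]
        simp
      rw [this, norm_mul, hu, one_mul]
    have h2 : ‖1 - (starRingEnd ℂ) u * x‖ ≤ ‖1 - (starRingEnd ℂ) z * x‖ + (1 - ‖z‖) := by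
      have e : 1 - (starRingEnd ℂ) u * x = (1 - (starRingEnd ℂ) z * x)
          + ((‖z‖ - 1 : ℝ) : ℂ) * ((starRingEnd ℂ) u * x) := by
        have hc : (starRingEnd ℂ) z = ‖z‖ * (starRingEnd ℂ) u := by
          conv_lhs => rw [hzu, map_mul, Complex.conj_ofReal]
        rw [hc]
        push_cast
        ring
      rw [e]
      refine (norm_add_le _ _).trans ?_
      gcongr
      rw [norm_mul, Complex.norm_real, norm_mul, RCLike.norm_conj, hu, one_mul, Real.norm_eq_abs,
        abs_of_nonpos (by linarith)]
      nlinarith [norm_nonneg x]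
    have h3 := one_sub_norm_le_norm_one_sub (z := z) hx'.le
    rw [div_le_div_iff₀ hd hpos, h1]
    linarith
  calc ∫⁻ x in disk, ENNReal.ofReal (1 / ‖1 - (starRingEnd ℂ) z * x‖)
      ≤ ∫⁻ x in disk, (Metric.ball (0 : ℂ) 2).indicator
          (fun y => ENNReal.ofReal (2 / ‖y‖)) (u - x) := setLIntegral_mono' measurableSet_ball key
    _ ≤ ∫⁻ x, (Metric.ball (0 : ℂ) 2).indicator
          (fun y => ENNReal.ofReal (2 / ‖y‖)) (u - x) := setLIntegral_le_lintegral _ _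
    _ = ∫⁻ y in Metric.ball (0 : ℂ) 2, ENNReal.ofReal (2 / ‖y‖) := by
      rw [lintegral_sub_left_eq_self, lintegral_indicator measurableSet_ball]

theorem lintegral_inv_norm_one_sub_cube {z : ℂ} (hz : z ∈ disk) :
    ∫⁻ w in disk, ENNReal.ofReal (1 / ‖1 - (starRingEnd ℂ) z * w‖ ^ 3)
      = ENNReal.ofReal (1 / (1 - ‖z‖ ^ 2))
        * ∫⁻ x in disk, ENNReal.ofReal (1 / ‖1 - (starRingEnd ℂ) z * x‖) := by
  have h := setLIntegral_pseudoBall hz le_rfl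
    (fun w => ENNReal.ofReal (1 / ‖1 - (starRingEnd ℂ) z * w‖ ^ 3))
  rw [pseudoBall_one hz] at h
  rw [h, ← lintegral_const_mul' _ _ ENNReal.ofReal_ne_top]
  refine setLIntegral_congr_fun measurableSet_ball fun x hx => ?_
  have hx' := (mem_disk.1 hx).le
  have hz1 := one_sub_sq_pos hz
  have hd := norm_pos_iff.2 (one_sub_conj_mul_ne_zero hz hx')
  rw [← ENNReal.ofReal_mul (mobJac_nonneg _ _), ← ENNReal.ofReal_mul (by positivity),
    one_sub_conj_mul_mob hz hx', mobJac, norm_div, Complex.norm_real,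
    Real.norm_of_nonneg hz1.le]
  congr 1
  field_simp

theorem measurable_inv_norm_one_sub_cube (z : ℂ) :
    Measurable fun w : ℂ => 1 / ‖1 - (starRingEnd ℂ) z * w‖ ^ 3 := by fun_prop

theorem exists_integral_inv_norm_one_sub_cube_le :
    ∃ C : ℝ, 0 ≤ C ∧ ∀ z ∈ disk,
      ∫ w in disk, 1 / ‖1 - (starRingEnd ℂ) z * w‖ ^ 3 ≤ C / (1 - ‖z‖ ^ 2) := by
  refine ⟨(∫⁻ y in Metric.ball (0 : ℂ) 2, ENNReal.ofReal (2 / ‖y‖)).toReal,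
    ENNReal.toReal_nonneg, fun z hz => ?_⟩
  rw [integral_eq_lintegral_of_nonneg_ae (ae_of_all _ fun w => by positivity)
    (measurable_inv_norm_one_sub_cube z).aestronglyMeasurable,
    lintegral_inv_norm_one_sub_cube hz, ENNReal.toReal_mul,
    ENNReal.toReal_ofReal (one_div_nonneg.2 (one_sub_sq_pos hz).le),
    div_eq_mul_one_div (ENNReal.toReal _), mul_comm (ENNReal.toReal _) (1 / _)]
  exact mul_le_mul_of_nonneg_left (ENNReal.toReal_mono (lintegral_ball_inv_norm_lt_top 2).ne
    (lintegral_inv_norm_one_sub_le hz)) (one_div_nonneg.2 (one_sub_sq_pos hz).le)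

theorem norm_one_sub_mul_conj_ge {z w : ℂ} (hw : w ∈ disk) :
    1 - ‖z‖ ≤ ‖1 - z * (starRingEnd ℂ) w‖ := by
  rw [norm_one_sub_mul_conj]
  exact one_sub_norm_le_norm_one_sub (mem_disk.1 hw).le

/-- Differentiation of the Bergman kernel integral under the integral sign. -/
theorem hasDerivAt_bergman_integral {μ : ℂ → ℂ}
    (hμ : AEStronglyMeasurable μ (volume.restrict disk)) {M : ℝ}
    (hM : ∀ᵐ w ∂volume.restrict disk, ‖μ w‖ ≤ M) {z : ℂ} (hz : z ∈ disk) :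
    HasDerivAt (fun z => ∫ w in disk, μ w / (1 - z * (starRingEnd ℂ) w) ^ 2)
      (∫ w in disk, 2 * (μ w * (starRingEnd ℂ) w) * (1 / (1 - z * (starRingEnd ℂ) w) ^ 3)) z := by
  have hz' := mem_disk.1 hz
  set ε := (1 - ‖z‖) / 2 with hε
  have hε0 : 0 < ε := by linarith
  have hball : ∀ x ∈ Metric.ball z ε, ∀ w ∈ disk, ε ≤ ‖1 - x * (starRingEnd ℂ) w‖ := by
    intro x hx w hw
    have h1 := norm_one_sub_mul_conj_ge (z := x) hw
    have h2 : ‖x - z‖ < ε := by simpa [dist_eq_norm] using hx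
    have h3 := norm_sub_norm_le x z
    linarith
  have hmeas : ∀ (n : ℕ) (x : ℂ), Measurable fun w : ℂ => (1 - x * (starRingEnd ℂ) w) ^ n := by
    intro n x
    have : Measurable (starRingEnd ℂ) := Complex.continuous_conj.measurable
    fun_prop
  refine (hasDerivAt_integral_of_dominated_loc_of_deriv_le (μ := volume.restrict disk)
    (F := fun z w => μ w / (1 - z * (starRingEnd ℂ) w) ^ 2)
    (F' := fun z w => 2 * (μ w * (starRingEnd ℂ) w) * (1 / (1 - z * (starRingEnd ℂ) w) ^ 3))
    (bound := fun _ => 2 * (M * 1) * (1 / ε ^ 3))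
    (Metric.ball_mem_nhds z hε0) ?_ ?_ ?_ ?_ ?_ ?_).2
  · exact Eventually.of_forall fun x =>
      (hμ.aemeasurable.div (hmeas 2 x).aemeasurable).aestronglyMeasurable
  · refine IntegrableOn.of_bound measure_ball_lt_top
      (hμ.aemeasurable.div (hmeas 2 z).aemeasurable).aestronglyMeasurable (M / ε ^ 2) ?_
    filter_upwards [hM, ae_restrict_mem measurableSet_ball] with w hw hwd
    have := hball z (Metric.mem_ball_self hε0) w hwd
    rw [norm_div, norm_pow]
    have : 0 ≤ M := (norm_nonneg _).trans hw
    gcongr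
  · exact ((hμ.mul Complex.continuous_conj.measurable.aestronglyMeasurable).const_mul 2).mul
      (measurable_const.div (hmeas 3 z)).aestronglyMeasurable
  · filter_upwards [hM, ae_restrict_mem measurableSet_ball] with w hw hwd x hx
    have h1 := hball x hx w hwd
    have h2 := (mem_disk.1 hwd).le
    have h0 : 0 ≤ M := (norm_nonneg _).trans hw
    rw [norm_mul, norm_mul, norm_mul, norm_div, norm_pow, RCLike.norm_conj, norm_one]
    rw [show ‖(2 : ℂ)‖ = 2 by simp]
    gcongr
  · exact integrableOn_const measure_ball_lt_top.ne
  · filter_upwards [ae_restrict_mem measurableSet_ball] with w hwd x hx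
    have h1 := hball x hx w hwd
    have h2 : 1 - x * (starRingEnd ℂ) w ≠ 0 := norm_pos_iff.1 (hε0.trans_le h1)
    have h3 : HasDerivAt (fun x : ℂ => 1 - x * (starRingEnd ℂ) w) (-(1 * (starRingEnd ℂ) w)) x :=
      ((hasDerivAt_id x).mul_const _).const_sub 1
    convert! (h3.fun_pow 2).fun_inv (pow_ne_zero 2 h2) |>.const_mul (μ w) using 1
    push_cast
    field_simp

theorem ae_norm_le_LInfty (μ : LInftyDisk) : ∀ᵐ w ∂volume.restrict disk, ‖μ w‖ ≤ ‖μ‖ := by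
  have h := ae_le_eLpNormEssSup (f := μ) (μ := volume.restrict disk)
  have h2 := Lp.eLpNorm_ne_top μ
  filter_upwards [h] with w hw
  rw [Lp.norm_def, eLpNorm_exponent_top]
  rw [eLpNorm_exponent_top] at h2
  simpa using ENNReal.toReal_mono h2 hw

theorem hasDerivAt_bergmanProj (μ : LInftyDisk) {z : ℂ} (hz : z ∈ disk) :
    HasDerivAt (bergmanProj μ) (2 / Real.pi * ∫ w in disk, μ w * (starRingEnd ℂ) w
      * (1 / (1 - z * (starRingEnd ℂ) w) ^ 3)) z := by
  have h := (hasDerivAt_bergman_integral (Lp.aestronglyMeasurable μ) (ae_norm_le_LInfty μ)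
    hz).const_mul (1 / (Real.pi : ℂ))
  convert! h using 1
  simp only [mul_assoc]
  rw [integral_const_mul]
  ring

theorem bergmanProj_mem_blochSpace (μ : LInftyDisk) : bergmanProj μ ∈ blochSpace := by
  obtain ⟨C, hC0, hC⟩ := exists_integral_inv_norm_one_sub_cube_le
  refine ⟨fun z hz => (hasDerivAt_bergmanProj μ hz).differentiableAt.differentiableWithinAt,
    2 / Real.pi * (‖μ‖ * C), ?_⟩
  rintro _ ⟨z, hz, rfl⟩
  have hz1 := one_sub_sq_pos hz
  have hz2 := mem_disk.1 hz
  rw [blochQuotient, (hasDerivAt_bergmanProj μ hz).deriv, norm_mul, norm_div, Complex.norm_real,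
    Real.norm_of_nonneg Real.pi_pos.le, show ‖(2 : ℂ)‖ = 2 by simp]
  have h1 : ‖∫ w in disk, μ w * (starRingEnd ℂ) w * (1 / (1 - z * (starRingEnd ℂ) w) ^ 3)‖
      ≤ ∫ w in disk, ‖μ‖ * (1 / ‖1 - (starRingEnd ℂ) z * w‖ ^ 3) := by
    refine norm_integral_le_of_norm_le ?_ ?_
    · refine Integrable.const_mul ?_ _
      refine IntegrableOn.of_bound measure_ball_lt_top
        (measurable_inv_norm_one_sub_cube z).aestronglyMeasurable (1 / (1 - ‖z‖) ^ 3) ?_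
      filter_upwards [ae_restrict_mem measurableSet_ball] with w hw
      have h2 := one_sub_norm_le_norm_one_sub (z := z) (mem_disk.1 hw).le
      have h3 : 0 < 1 - ‖z‖ := by linarith
      rw [Real.norm_of_nonneg (by positivity)]
      gcongr
    · filter_upwards [ae_norm_le_LInfty μ, ae_restrict_mem measurableSet_ball] with w hw hwd
      rw [norm_mul, norm_mul, norm_div, norm_pow, RCLike.norm_conj, norm_one,
        norm_one_sub_mul_conj]
      have := (mem_disk.1 hwd).le
      gcongr
      nlinarith [norm_nonneg w, norm_nonneg (μ w)]
  rw [integral_const_mul] at h1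
  have h2 := hC z hz
  calc (1 - ‖z‖ ^ 2) * (2 / Real.pi * _) ≤ (1 - ‖z‖ ^ 2) * (2 / Real.pi *
        (‖μ‖ * (C / (1 - ‖z‖ ^ 2)))) := by
        have := Real.pi_pos
        gcongr
        exact h1.trans (by gcongr)
    _ = 2 / Real.pi * (‖μ‖ * C) := by field_simp

/-- A holomorphic function with bounded derivative belongs to the little Bloch space. -/
theorem mem_littleBlochSpace_of_deriv_bounded {b : blochSpace} {M : ℝ}
    (hM : ∀ z ∈ disk, ‖deriv (b : ℂ → ℂ) z‖ ≤ M) : b ∈ littleBlochSpace := by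
  have hev : ∀ᶠ z : ℂ in comap (fun z : ℂ => ‖z‖) (𝓝[<] 1), z ∈ disk := by
    have h : ∀ᶠ r : ℝ in 𝓝[<] 1, r < 1 := self_mem_nhdsWithin
    filter_upwards [h.comap (fun z : ℂ => ‖z‖)] with z hz
    simpa using hz
  have hlim : Tendsto (fun z : ℂ => (1 - ‖z‖ ^ 2) * M) (comap (fun z : ℂ => ‖z‖) (𝓝[<] 1))
      (𝓝 0) := by
    have h1 : Tendsto (fun r : ℝ => (1 - r ^ 2) * M) (𝓝[<] 1) (𝓝 0) := by
      have h2 : Continuous fun r : ℝ => (1 - r ^ 2) * M := by fun_prop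
      have h3 := h2.tendsto 1
      simp only [one_pow, sub_self, zero_mul] at h3
      exact h3.mono_left nhdsWithin_le_nhds
    exact h1.comp tendsto_comap
  refine tendsto_of_tendsto_of_tendsto_of_le_of_le' tendsto_const_nhds hlim ?_ ?_
  · filter_upwards [hev] with z hz using blochQuotient_nonneg _ hz
  · filter_upwards [hev] with z hz
    exact mul_le_mul_of_nonneg_left (hM z hz) (one_sub_sq_pos hz).le

theorem mkQ_eq_of_eqOn_disk {f g : blochSpace} (h : Set.EqOn (f : ℂ → ℂ) g disk) :
    littleBlochSpace.mkQ f = littleBlochSpace.mkQ g := by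
  rw [Submodule.mkQ_apply, Submodule.mkQ_apply, Submodule.Quotient.eq]
  refine mem_littleBlochSpace_of_deriv_bounded (M := 0) fun z hz => ?_
  have h1 : ((f - g : blochSpace) : ℂ → ℂ) =ᶠ[𝓝 z] fun _ => 0 := by
    filter_upwards [Metric.isOpen_ball.mem_nhds hz] with w hw
    simp [h hw]
  rw [h1.deriv_eq]
  simp

theorem integrable_bergman_integrand (μ : LInftyDisk) {z : ℂ} (hz : z ∈ disk) :
    IntegrableOn (fun w => μ w / (1 - z * (starRingEnd ℂ) w) ^ 2) disk := by
  have hz' := mem_disk.1 hz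
  have hm : Measurable (starRingEnd ℂ) := Complex.continuous_conj.measurable
  refine IntegrableOn.of_bound measure_ball_lt_top
      ((Lp.aestronglyMeasurable μ).aemeasurable.div
        (by fun_prop : Measurable fun w : ℂ =>
          (1 - z * (starRingEnd ℂ) w) ^ 2).aemeasurable).aestronglyMeasurable
      (‖μ‖ / (1 - ‖z‖) ^ 2) ?_
  filter_upwards [ae_norm_le_LInfty μ, ae_restrict_mem measurableSet_ball] with w hw hwd
  have h1 := norm_one_sub_mul_conj_ge (z := z) hwd
  have h2 : 0 < 1 - ‖z‖ := by linarith
  rw [norm_div, norm_pow]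
  gcongr

/-- Additivity holds only on the disk: elsewhere the integrals may diverge. -/
theorem bergmanProj_add (μ ν : LInftyDisk) :
    Set.EqOn (bergmanProj (μ + ν)) (bergmanProj μ + bergmanProj ν) disk := by
  intro z hz
  rw [Pi.add_apply, bergmanProj, bergmanProj, bergmanProj, ← mul_add,
    ← integral_add (integrable_bergman_integrand μ hz) (integrable_bergman_integrand ν hz)]
  congr 1
  refine integral_congr_ae ?_
  filter_upwards [Lp.coeFn_add μ ν] with w hw
  rw [hw, Pi.add_apply, add_div]

theorem bergmanProj_smul (c : ℂ) (μ : LInftyDisk) :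
    bergmanProj (c • μ) = c • bergmanProj μ := by
  ext z
  rw [Pi.smul_apply, bergmanProj, bergmanProj, smul_eq_mul, mul_left_comm, ← integral_const_mul c]
  congr 1
  refine integral_congr_ae ?_
  filter_upwards [Lp.coeFn_smul c μ] with w hw
  rw [hw, Pi.smul_apply, smul_eq_mul, mul_div_assoc]

/-- The linear map `L^∞(𝔻) → 𝓑/𝓑₀` induced by the Bergman projection. -/
def bergmanProjQuot : LInftyDisk →ₗ[ℂ] blochSpace ⧸ littleBlochSpace where
  toFun μ := littleBlochSpace.mkQ ⟨bergmanProj μ, bergmanProj_mem_blochSpace μ⟩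
  map_add' μ ν := by
    rw [← map_add]
    exact mkQ_eq_of_eqOn_disk (bergmanProj_add μ ν)
  map_smul' c μ := by
    rw [RingHom.id_apply, ← map_smul]
    exact congrArg _ (Subtype.ext (bergmanProj_smul c μ))

/-! ### Sweeping along pseudohyperbolic disks -/

/-- The density `(1 - |w|²) |f(w)|`; for `f = b'` it is the Bloch quotient of `b`. -/
def blochDensity (f : ℂ → ℂ) (w : ℂ) : ℝ := (1 - ‖w‖ ^ 2) * ‖f w‖

theorem blochDensity_nonneg (f : ℂ → ℂ) {w : ℂ} (hw : w ∈ disk) : 0 ≤ blochDensity f w :=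
  mul_nonneg (one_sub_sq_pos hw).le (norm_nonneg _)

theorem measurable_blochDensity {f : ℂ → ℂ} (hf : Measurable f) : Measurable (blochDensity f) := by
  unfold blochDensity
  fun_prop

/-- The density varies slowly in the pseudohyperbolic metric: by the Schwarz lemma on `|x| < 1/2`,
where `|F| ≤ 4/3` for `F = (f ∘ φ_z) φ_z'`, one has `|F(x) - F(0)| ≤ 16/3 |x| < 2/15` for
`|x| < 1/40`. -/
theorem blochDensity_ge_of_mem_pseudoBall {f : ℂ → ℂ} (hf : DifferentiableOn ℂ f disk)
    (hf1 : ∀ w ∈ disk, blochDensity f w ≤ 1) {z w : ℂ} (hz : z ∈ disk)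
    (hzf : 1 / 2 ≤ blochDensity f z) (hw : w ∈ pseudoBall z (1 / 40)) :
    1 / 4 ≤ blochDensity f w := by
  have hz1 := one_sub_sq_pos hz
  set F : ℂ → ℂ := fun x =>
    ((1 - ‖z‖ ^ 2 : ℝ) : ℂ) * (f (mob z x) / (1 - (starRingEnd ℂ) z * x) ^ 2) with hF
  have hFd : DifferentiableOn ℂ F disk := by
    refine DifferentiableOn.const_mul ((differentiableOn_comp_mob hz hf).div (by fun_prop) ?_) _
    intro x hx
    exact pow_ne_zero 2 (one_sub_conj_mul_ne_zero hz (mem_disk.1 hx).le)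
  have hFn : ∀ x ∈ disk, (1 - ‖x‖ ^ 2) * ‖F x‖ = blochDensity f (mob z x) := by
    intro x hx
    rw [hF, blochDensity, one_sub_norm_mob_sq hz (mem_disk.1 hx).le, norm_mul, norm_div, norm_pow,
      Complex.norm_real, Real.norm_of_nonneg hz1.le]
    ring
  have hsub : Metric.ball (0 : ℂ) (1 / 2) ⊆ disk := ball_subset_disk (by norm_num)
  have hFb : ∀ x ∈ Metric.ball (0 : ℂ) (1 / 2), ‖F x‖ ≤ 4 / 3 := by
    intro x hx
    have h1 := hFn x (hsub hx)
    have h2 := hf1 _ (mob_mem_disk hz (hsub hx))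
    have h3 : ‖x‖ < 1 / 2 := by simpa using hx
    have h4 : ‖x‖ ^ 2 ≤ 1 / 4 := by nlinarith [norm_nonneg x]
    nlinarith [mul_nonneg (sub_nonneg.2 h4) (norm_nonneg (F x))]
  have h0 : (0 : ℂ) ∈ Metric.ball (0 : ℂ) (1 / 2) := by simp
  have hmaps : Set.MapsTo F (Metric.ball 0 (1 / 2)) (Metric.closedBall (F 0) (8 / 3)) := by
    intro x hx
    rw [Metric.mem_closedBall, dist_eq_norm]
    have := norm_sub_le (F x) (F 0)
    linarith [hFb x hx, hFb 0 h0]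
  set x := mob z w with hx
  have hxn : ‖x‖ < 1 / 40 := hw.2
  have hxd : x ∈ disk := mob_mem_disk hz hw.1
  have hd := Complex.dist_le_div_mul_dist_of_mapsTo_ball (hFd.mono hsub) hmaps
    (z := x) (by simp; linarith)
  rw [dist_zero_right, dist_eq_norm] at hd
  have h5 : ‖F 0‖ = blochDensity f z := by
    have := hFn 0 (hsub h0)
    simpa [mob_zero_right] using this
  have h6 := norm_sub_norm_le (F 0) (F x)
  rw [norm_sub_rev] at h6
  have h7 := hFn x hxd
  rw [hx, mob_mob hz hw.1, ← hx] at h7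
  rw [← h7]
  have h8 : 11 / 30 ≤ ‖F x‖ := by linarith
  have h9 : ‖x‖ ^ 2 ≤ 1 / 1600 := by nlinarith [norm_nonneg x]
  nlinarith [mul_nonneg (sub_nonneg.2 h9) (norm_nonneg (F x))]

/-- The kernel through which the mass of `(1 - |z|²) f(z)` at `z` is spread over the
pseudohyperbolic disk of radius `r` about `z`. In the coordinate `w = φ_z(x)` and with `F = (f ∘ φ_z) φ_z'` it is the
uniform density times `F(0)` times the conjugate of `(F(0) / F(x))³`. -/
def sweepKernel (r : ℝ) (f : ℂ → ℂ) (z w : ℂ) : ℂ :=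
  (((1 - ‖z‖ ^ 2) ^ 5 / (Real.pi * r ^ 2) / ‖1 - (starRingEnd ℂ) z * w‖ ^ 4 : ℝ) : ℂ)
    * (f z * (starRingEnd ℂ) (f z ^ 3 * (1 / ((1 - (starRingEnd ℂ) z * w) ^ 2 * f w ^ 3))))

/-- Sweeping does not change the pairing with conjugates of holomorphic functions: in the coordinate
`x` this is the mean value property of `G / F³`. -/
theorem setIntegral_sweepKernel {f g : ℂ → ℂ} (hf : DifferentiableOn ℂ f disk)
    (hg : DifferentiableOn ℂ g disk) {M : ℝ} (hM : ∀ w ∈ disk, ‖g w‖ ≤ M) {z : ℂ} (hz : z ∈ disk)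
    {r : ℝ} (hr0 : 0 < r) (hr : r ≤ 1) (hlow : ∀ w ∈ pseudoBall z r, 1 / 4 ≤ ‖f w‖) :
    ∫ w in pseudoBall z r, sweepKernel r f z w * (starRingEnd ℂ) (g w)
      = ((1 - ‖z‖ ^ 2 : ℝ) : ℂ) * f z * (starRingEnd ℂ) (g z) := by
  have hz1 := one_sub_sq_pos hz
  have hz3 : ((1 - ‖z‖ ^ 2 : ℝ) : ℂ) ≠ 0 := by exact_mod_cast hz1.ne'
  have hlow' : ∀ x ∈ Metric.ball (0 : ℂ) r, 1 / 4 ≤ ‖f (mob z x)‖ := by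
    intro x hx
    refine hlow _ ?_
    rw [← mob_image_ball hz hr]
    exact ⟨x, hx, rfl⟩
  set h : ℂ → ℂ := fun x =>
    g (mob z x) * (1 - (starRingEnd ℂ) z * x) ^ 2 / f (mob z x) ^ 3 with hh
  have hsub := ball_subset_disk hr
  have hhd : DifferentiableOn ℂ h (Metric.ball 0 r) := by
    refine DifferentiableOn.div (((differentiableOn_comp_mob hz hg).mono hsub).mul (by fun_prop))
      (((differentiableOn_comp_mob hz hf).mono hsub).pow 3) ?_
    intro x hx
    refine pow_ne_zero 3 (norm_pos_iff.1 ?_)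
    linarith [hlow' x hx]
  have hmv := setIntegral_ball_radial_mul (κ := fun _ => 1) (C := M * 2 ^ 2 / (1 / 4) ^ 3)
    measurable_const hhd (by
      intro x hx
      have h1 := hM _ (mob_mem_disk hz (hsub hx))
      have h2 : ‖1 - (starRingEnd ℂ) z * x‖ ≤ 2 := by
        refine (norm_sub_le _ _).trans ?_
        rw [norm_one, norm_mul, RCLike.norm_conj]
        have := mem_disk.1 hz
        have := mem_disk.1 (hsub hx)
        nlinarith [norm_nonneg x, norm_nonneg z]
      have h3 := hlow' x hx
      have h4 : 0 ≤ M := (norm_nonneg _).trans h1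
      rw [one_mul, hh, norm_div, norm_mul, norm_pow, norm_pow]
      gcongr)
  have hvol : ∫ _ in Metric.ball (0 : ℂ) r, (1 : ℂ) = Real.pi * r ^ 2 := by
    rw [setIntegral_const, Measure.real, Complex.volume_ball]
    simp [hr0.le]
    ring
  simp only [one_mul, hvol] at hmv
  have key : ∀ x ∈ Metric.ball (0 : ℂ) r, (mobJac z x : ℂ) *
      (sweepKernel r f z (mob z x) * (starRingEnd ℂ) (g (mob z x)))
      = (((1 - ‖z‖ ^ 2) / (Real.pi * r ^ 2) : ℝ) : ℂ) * (f z * (starRingEnd ℂ) (f z ^ 3))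
        * (starRingEnd ℂ) (h x) := by
    intro x hx
    have hx' := (mem_disk.1 (hsub hx)).le
    have hd := one_sub_conj_mul_ne_zero hz hx'
    have hf0 : f (mob z x) ≠ 0 := norm_pos_iff.1 (by linarith [hlow' x hx])
    have hd2 : (((‖1 - (starRingEnd ℂ) z * x‖ : ℝ)) : ℂ) ≠ 0 := by simpa using hd
    rw [sweepKernel, mobJac, one_sub_conj_mul_mob hz hx', hh]
    simp only [map_mul, map_div₀, map_pow, map_one, Complex.conj_ofReal, norm_div,
      Complex.norm_real, Real.norm_of_nonneg hz1.le]
    have hd3 : (starRingEnd ℂ) (1 - (starRingEnd ℂ) z * x) ≠ 0 := (map_ne_zero _).2 hd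
    have hf3 : (starRingEnd ℂ) (f (mob z x)) ≠ 0 := (map_ne_zero _).2 hf0
    have hpi : (Real.pi : ℂ) ≠ 0 := by exact_mod_cast Real.pi_pos.ne'
    have hrc : (r : ℂ) ≠ 0 := by exact_mod_cast hr0.ne'
    generalize (starRingEnd ℂ) (1 - (starRingEnd ℂ) z * x) = d' at *
    generalize 1 - ‖z‖ ^ 2 = t at *
    generalize ‖1 - (starRingEnd ℂ) z * x‖ = n at *
    push_cast
    field_simp
  rw [setIntegral_pseudoBall hz hr, setIntegral_congr_fun measurableSet_ball key,
    integral_const_mul, integral_conj, hmv, hh]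
  have hf0 : (starRingEnd ℂ) (f z) ≠ 0 := by
    refine (map_ne_zero _).2 (norm_pos_iff.1 ?_)
    have := hlow' 0 (by simpa using hr0)
    rw [mob_zero_right] at this
    linarith
  have hpi : (Real.pi : ℂ) ≠ 0 := by exact_mod_cast Real.pi_pos.ne'
  have hrc : (r : ℂ) ≠ 0 := by exact_mod_cast hr0.ne'
  simp only [mob_zero_right, mul_zero, sub_zero, one_pow, mul_one, map_mul, map_div₀, map_pow,
    Complex.conj_ofReal]
  generalize 1 - ‖z‖ ^ 2 = t at *
  push_cast
  field_simp

/-- The Möbius invariant density that dominates the sweeping kernel. -/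
def sweepWeight (r : ℝ) (z w : ℂ) : ℝ :=
  (1 - ‖z‖ ^ 2) * (1 - ‖w‖ ^ 2) ^ 3 / ‖1 - (starRingEnd ℂ) z * w‖ ^ 6 / (Real.pi * r ^ 2)

theorem sweepWeight_nonneg {r : ℝ} {z w : ℂ} (hz : z ∈ disk) (hw : w ∈ disk) :
    0 ≤ sweepWeight r z w := by
  have := one_sub_sq_pos hz
  have := one_sub_sq_pos hw
  have := Real.pi_pos
  unfold sweepWeight
  positivity

theorem norm_sweepKernel {r : ℝ} {f : ℂ → ℂ} {z w : ℂ} (hz : z ∈ disk) (hw : w ∈ disk) :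
    ‖sweepKernel r f z w‖
      = blochDensity f z ^ 4 * (blochDensity f w ^ 3)⁻¹ * sweepWeight r z w := by
  have hz1 := one_sub_sq_pos hz
  have hw1 := one_sub_sq_pos hw
  have hd := norm_pos_iff.2 (one_sub_conj_mul_ne_zero hz (mem_disk.1 hw).le)
  have hpi := Real.pi_pos
  rw [sweepKernel, norm_mul, Complex.norm_real, Real.norm_of_nonneg (by positivity), norm_mul,
    RCLike.norm_conj, norm_mul, norm_div, norm_mul, norm_pow, norm_pow, norm_pow, norm_one,
    blochDensity, blochDensity, sweepWeight, mul_pow, mul_pow, mul_inv]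
  field_simp

/-- The total mass that is swept to `w`. The factor `(1 - |x|²)³` gained from `|F(x)|⁻³` outweighs
the hyperbolic area density `(1 - |x|²)⁻²`, so that the mass is smaller than `1`. -/
theorem lintegral_sweepWeight {r : ℝ} (hr0 : 0 < r) (hr : r ≤ 1) {w : ℂ} (hw : w ∈ disk) :
    ∫⁻ z in pseudoBall w r, ENNReal.ofReal (sweepWeight r z w)
      = ENNReal.ofReal (1 - r ^ 2 / 2) := by
  have hpi := Real.pi_pos
  rw [setLIntegral_pseudoBall hw hr]
  have key : ∀ x ∈ Metric.ball (0 : ℂ) r, ENNReal.ofReal (mobJac w x) *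
      ENNReal.ofReal (sweepWeight r (mob w x) w)
      = ENNReal.ofReal ((1 - ‖x‖ ^ 2) * (1 / (Real.pi * r ^ 2))) := by
    intro x hx
    have hxd := ball_subset_disk hr hx
    have hx' := (mem_disk.1 hxd).le
    have hw1 := one_sub_sq_pos hw
    have hd := norm_pos_iff.2 (one_sub_conj_mul_ne_zero hw hx')
    rw [← ENNReal.ofReal_mul (mobJac_nonneg _ _), mobJac, sweepWeight,
      norm_one_sub_conj_mul_comm (mob w x) w, one_sub_conj_mul_mob hw hx',
      one_sub_norm_mob_sq hw hx',
      norm_div, Complex.norm_real, Real.norm_of_nonneg hw1.le]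
    congr 1
    field_simp
  rw [setLIntegral_congr_fun measurableSet_ball key, ← ofReal_integral_eq_lintegral_ofReal]
  · rw [integral_mul_const, integral_ball_one_sub_sq hr0.le]
    congr 1
    field_simp
  · refine IntegrableOn.of_bound measure_ball_lt_top
      (by fun_prop) (1 * (1 / (Real.pi * r ^ 2))) ?_
    filter_upwards [ae_restrict_mem measurableSet_ball] with x hx
    have := one_sub_sq_pos (ball_subset_disk hr hx)
    rw [Real.norm_of_nonneg (by positivity)]
    gcongr
    nlinarith [norm_nonneg x]
  · filter_upwards [ae_restrict_mem measurableSet_ball] with x hx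
    have := one_sub_sq_pos (ball_subset_disk hr hx)
    simp only [Pi.zero_apply]
    positivity

/-! ### Lowering the density -/

/-- The points where the density of `f` is at least `1/2`; only the mass there is swept. -/
def largeSet (f : ℂ → ℂ) : Set ℂ := {z | z ∈ disk ∧ 1 / 2 ≤ blochDensity f z}

theorem measurableSet_largeSet {f : ℂ → ℂ} (hf : Measurable f) : MeasurableSet (largeSet f) :=
  measurableSet_ball.inter (measurableSet_le measurable_const (measurable_blochDensity hf))

/-- The pairs `(z, w)` for which mass is swept from `z` to `w`. -/
def sweepRegion (f : ℂ → ℂ) : Set (ℂ × ℂ) :=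
  {p | p.1 ∈ largeSet f ∧ p.2 ∈ disk ∧ ‖mob p.1 p.2‖ < 1 / 40}

theorem measurableSet_sweepRegion {f : ℂ → ℂ} (hf : Measurable f) :
    MeasurableSet (sweepRegion f) :=
  (measurable_fst (measurableSet_largeSet hf)).inter
    ((measurable_snd measurableSet_ball).inter
      (measurableSet_lt measurable_mob_uncurry.norm measurable_const))

/-- The sweeping kernel of radius `1/40`, cut off to `sweepRegion f`. -/
def cutKernel (f : ℂ → ℂ) : ℂ × ℂ → ℂ :=
  (sweepRegion f).indicator fun p => sweepKernel (1 / 40) f p.1 p.2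

theorem measurable_cutKernel {f : ℂ → ℂ} (hf : Measurable f) : Measurable (cutKernel f) := by
  refine Measurable.indicator ?_ (measurableSet_sweepRegion hf)
  have hm : Measurable (starRingEnd ℂ) := Complex.continuous_conj.measurable
  unfold sweepKernel
  fun_prop

theorem cutKernel_eq_zero {f : ℂ → ℂ} (hf : DifferentiableOn ℂ f disk)
    (hf1 : ∀ w ∈ disk, blochDensity f w ≤ 1) {w : ℂ} (hw : blochDensity f w < 1 / 4) (z : ℂ) :
    cutKernel f (z, w) = 0 := by
  refine Set.indicator_of_notMem (fun h => hw.not_ge ?_) _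
  exact blochDensity_ge_of_mem_pseudoBall hf hf1 h.1.1 h.1.2 h.2

theorem lintegral_cutKernel_le {f : ℂ → ℂ} (hf1 : ∀ w ∈ disk, blochDensity f w ≤ 1) {w : ℂ}
    (hw : w ∈ disk) :
    ∫⁻ z in disk, ‖cutKernel f (z, w)‖ₑ
      ≤ ENNReal.ofReal ((blochDensity f w ^ 3)⁻¹ * (3199 / 3200)) := by
  have hA := blochDensity_nonneg f hw
  have key : ∀ z, ‖cutKernel f (z, w)‖ₑ ≤ (pseudoBall w (1 / 40)).indicator
      (fun z => ENNReal.ofReal ((blochDensity f w ^ 3)⁻¹)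
        * ENNReal.ofReal (sweepWeight (1 / 40) z w)) z := by
    intro z
    by_cases h : (z, w) ∈ sweepRegion f
    · have hz : z ∈ disk := h.1.1
      have h1 : z ∈ pseudoBall w (1 / 40) := ⟨hz, by rw [norm_mob_comm]; exact h.2.2⟩
      rw [cutKernel, Set.indicator_of_mem h, Set.indicator_of_mem h1,
        ← ENNReal.ofReal_mul (by positivity), ← ofReal_norm, norm_sweepKernel hz hw]
      apply ENNReal.ofReal_le_ofReal
      have h2 := sweepWeight_nonneg (r := 1 / 40) hz hw
      have h3 : blochDensity f z ^ 4 ≤ 1 := pow_le_one₀ (blochDensity_nonneg f hz) (hf1 z hz)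
      have h4 : 0 ≤ (blochDensity f w ^ 3)⁻¹ := by positivity
      have := mul_le_of_le_one_left h4 h3
      gcongr
    · rw [cutKernel, Set.indicator_of_notMem h]
      simp
  calc ∫⁻ z in disk, ‖cutKernel f (z, w)‖ₑ
      ≤ ∫⁻ z, (pseudoBall w (1 / 40)).indicator
          (fun z => ENNReal.ofReal ((blochDensity f w ^ 3)⁻¹)
            * ENNReal.ofReal (sweepWeight (1 / 40) z w)) z :=
        (setLIntegral_le_lintegral _ _).trans (lintegral_mono key)
    _ = ENNReal.ofReal ((blochDensity f w ^ 3)⁻¹ * (3199 / 3200)) := by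
      rw [lintegral_indicator (measurableSet_pseudoBall _ _),
        lintegral_const_mul' _ _ ENNReal.ofReal_ne_top,
        lintegral_sweepWeight (by norm_num) (by norm_num) hw,
        ← ENNReal.ofReal_mul (by positivity)]
      norm_num

/-- The density that results at `w` from sweeping all the mass on `largeSet f`. -/
def sweptDensity (f : ℂ → ℂ) (w : ℂ) : ℂ := ∫ z in disk, cutKernel f (z, w)

theorem stronglyMeasurable_sweptDensity {f : ℂ → ℂ} (hf : Measurable f) :
    StronglyMeasurable (sweptDensity f) :=
  (measurable_cutKernel hf).stronglyMeasurable.integral_prod_left'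

theorem norm_sweptDensity_le {f : ℂ → ℂ} (hf1 : ∀ w ∈ disk, blochDensity f w ≤ 1) {w : ℂ}
    (hw : w ∈ disk) : ‖sweptDensity f w‖ ≤ (blochDensity f w ^ 3)⁻¹ * (3199 / 3200) := by
  have hA := blochDensity_nonneg f hw
  have h := (enorm_integral_le_lintegral_enorm _).trans (lintegral_cutKernel_le hf1 hw)
  rw [← ofReal_norm] at h
  exact (ENNReal.ofReal_le_ofReal_iff (by positivity)).1 h

theorem lintegral_cutKernel_le_const {f : ℂ → ℂ} (hf : DifferentiableOn ℂ f disk)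
    (hf1 : ∀ w ∈ disk, blochDensity f w ≤ 1) {w : ℂ} (hw : w ∈ disk) :
    ∫⁻ z in disk, ‖cutKernel f (z, w)‖ₑ ≤ ENNReal.ofReal 64 := by
  rcases lt_or_ge (blochDensity f w) (1 / 4) with h | h
  · simp [cutKernel_eq_zero hf hf1 h]
  · refine (lintegral_cutKernel_le hf1 hw).trans (ENNReal.ofReal_le_ofReal ?_)
    have h1 : (1 / 4 : ℝ) ^ 3 ≤ blochDensity f w ^ 3 := by gcongr
    have h2 : (blochDensity f w ^ 3)⁻¹ ≤ ((1 / 4 : ℝ) ^ 3)⁻¹ := by gcongr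
    norm_num at h2 ⊢
    linarith

theorem norm_sweptDensity_le_const {f : ℂ → ℂ} (hf : DifferentiableOn ℂ f disk)
    (hf1 : ∀ w ∈ disk, blochDensity f w ≤ 1) {w : ℂ} (hw : w ∈ disk) :
    ‖sweptDensity f w‖ ≤ 64 := by
  have h := (enorm_integral_le_lintegral_enorm _).trans (lintegral_cutKernel_le_const hf hf1 hw)
  rw [← ofReal_norm] at h
  exact (ENNReal.ofReal_le_ofReal_iff (by norm_num)).1 h

theorem norm_ofReal_mul_eq_blochDensity (f : ℂ → ℂ) {w : ℂ} (hw : w ∈ disk) :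
    ‖((1 - ‖w‖ ^ 2 : ℝ) : ℂ) * f w‖ = blochDensity f w := by
  rw [norm_mul, Complex.norm_real, Real.norm_of_nonneg (one_sub_sq_pos hw).le, blochDensity]

theorem setIntegral_cutKernel {f g : ℂ → ℂ} (hf : DifferentiableOn ℂ f disk)
    (hf1 : ∀ w ∈ disk, blochDensity f w ≤ 1) (hg : DifferentiableOn ℂ g disk) {M : ℝ}
    (hM : ∀ w ∈ disk, ‖g w‖ ≤ M) {z : ℂ} (hz : z ∈ disk) :
    ∫ w in disk, cutKernel f (z, w) * (starRingEnd ℂ) (g w)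
      = (largeSet f).indicator
        (fun z => ((1 - ‖z‖ ^ 2 : ℝ) : ℂ) * f z) z * (starRingEnd ℂ) (g z) := by
  by_cases h : z ∈ largeSet f
  · have hlow : ∀ w ∈ pseudoBall z (1 / 40), 1 / 4 ≤ ‖f w‖ := by
      intro w hw
      have h1 := blochDensity_ge_of_mem_pseudoBall hf hf1 hz h.2 hw
      rw [blochDensity] at h1
      nlinarith [mul_nonneg (sq_nonneg ‖w‖) (norm_nonneg (f w))]
    have h2 : ∀ w ∈ disk, cutKernel f (z, w) * (starRingEnd ℂ) (g w)
        = (pseudoBall z (1 / 40)).indicator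
          (fun w => sweepKernel (1 / 40) f z w * (starRingEnd ℂ) (g w)) w := by
      intro w hw
      by_cases hzw : ‖mob z w‖ < 1 / 40
      · have h3 : (z, w) ∈ sweepRegion f := ⟨h, hw, hzw⟩
        have h4 : w ∈ pseudoBall z (1 / 40) := ⟨hw, hzw⟩
        rw [cutKernel, Set.indicator_of_mem h3, Set.indicator_of_mem h4]
      · have h3 : (z, w) ∉ sweepRegion f := fun hh => hzw hh.2.2
        have h4 : w ∉ pseudoBall z (1 / 40) := fun hh => hzw hh.2
        rw [cutKernel, Set.indicator_of_notMem h3, Set.indicator_of_notMem h4, zero_mul]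
    have h5 : disk ∩ pseudoBall z (1 / 40) = pseudoBall z (1 / 40) :=
      Set.inter_eq_right.2 fun w hw => hw.1
    rw [Set.indicator_of_mem h, ← setIntegral_sweepKernel (r := 1 / 40) hf hg hM hz (by norm_num)
      (by norm_num) hlow, setIntegral_congr_fun measurableSet_ball h2,
      setIntegral_indicator (measurableSet_pseudoBall _ _), h5]
  · have h1 : ∀ w, cutKernel f (z, w) = 0 := fun w =>
      Set.indicator_of_notMem (fun hh => h hh.1) _
    simp [h1, h]

theorem integral_sweptDensity_mul_conj {f g : ℂ → ℂ} (hfm : Measurable f)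
    (hf : DifferentiableOn ℂ f disk) (hf1 : ∀ w ∈ disk, blochDensity f w ≤ 1)
    (hg : DifferentiableOn ℂ g disk) {M : ℝ} (hM : ∀ w ∈ disk, ‖g w‖ ≤ M) :
    ∫ w in disk, sweptDensity f w * (starRingEnd ℂ) (g w)
      = ∫ w in disk, (largeSet f).indicator
        (fun w => ((1 - ‖w‖ ^ 2 : ℝ) : ℂ) * f w) w * (starRingEnd ℂ) (g w) := by
  have hgm : AEStronglyMeasurable (fun w => (starRingEnd ℂ) (g w)) (volume.restrict disk) :=
    Complex.continuous_conj.comp_aestronglyMeasurable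
      (hg.continuousOn.aestronglyMeasurable measurableSet_ball)
  have hmeas : AEStronglyMeasurable
      (Function.uncurry fun z w => cutKernel f (z, w) * (starRingEnd ℂ) (g w))
      ((volume.restrict disk).prod (volume.restrict disk)) :=
    (measurable_cutKernel hfm).aestronglyMeasurable.mul hgm.comp_snd
  have hint : Integrable (Function.uncurry fun z w => cutKernel f (z, w) * (starRingEnd ℂ) (g w))
      ((volume.restrict disk).prod (volume.restrict disk)) := by
    refine ⟨hmeas, ?_⟩
    rw [HasFiniteIntegral, lintegral_prod_symm _ hmeas.enorm]
    have hb : ∀ w ∈ disk, ∫⁻ z in disk, ‖Function.uncurry (fun z w => cutKernel f (z, w)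
        * (starRingEnd ℂ) (g w)) (z, w)‖ₑ ≤ ENNReal.ofReal 64 * ENNReal.ofReal M := by
      intro w hw
      simp only [Function.uncurry, enorm_mul]
      rw [lintegral_mul_const' _ _ enorm_ne_top]
      refine mul_le_mul' (lintegral_cutKernel_le_const hf hf1 hw) ?_
      rw [← ofReal_norm, RCLike.norm_conj]
      exact ENNReal.ofReal_le_ofReal (hM w hw)
    refine (setLIntegral_mono' measurableSet_ball hb).trans_lt ?_
    rw [setLIntegral_const]
    exact ENNReal.mul_lt_top (by finiteness) measure_ball_lt_top
  have hswap := integral_integral_swap hint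
  rw [setIntegral_congr_fun measurableSet_ball fun z hz =>
    setIntegral_cutKernel hf hf1 hg hM hz] at hswap
  rw [hswap]
  refine integral_congr_ae (ae_of_all _ fun w => ?_)
  simp only [sweptDensity]
  rw [integral_mul_const]

/-- Near-extremal values of the density can be lowered: there is a density bounded by an absolute
constant `c < 1` that has the same pairings as `(1 - |w|²) f(w)` with conjugates of bounded
holomorphic functions. It arises by sweeping a small proportion of the mass on `largeSet f`: where
the density of `f` is near `1`, less mass arrives than is removed, and elsewhere there is room for
the mass that arrives. -/
theorem exists_density_le_const_lt_one :
    ∃ c : ℝ, 0 < c ∧ c < 1 ∧ ∀ f : ℂ → ℂ, Measurable f → DifferentiableOn ℂ f disk →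
      (∀ w ∈ disk, blochDensity f w ≤ 1) →
      ∃ ν : ℂ → ℂ, Measurable ν ∧ (∀ w ∈ disk, ‖ν w‖ ≤ c) ∧
        ∀ (g : ℂ → ℂ) (M : ℝ), DifferentiableOn ℂ g disk → (∀ w ∈ disk, ‖g w‖ ≤ M) →
          ∫ w in disk, ν w * (starRingEnd ℂ) (g w)
            = ∫ w in disk, ((1 - ‖w‖ ^ 2 : ℝ) : ℂ) * f w * (starRingEnd ℂ) (g w) := by
  -- Values at least `1 - δ` with `δ = 1/19200` count as near-extremal; the proportion swept is
  -- `s = δ/128`. Near-extremal points receive at most `(1 - δ)⁻³ · 3199/3200 ≤ 6398/6399`, since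
  -- `(1 - δ)³ ≥ 6399/6400`; the other points receive at most `64 s = δ/2`.
  obtain ⟨s, hs⟩ : ∃ s : ℝ, s = 1 / 19200 / 128 := ⟨_, rfl⟩
  refine ⟨1 - s / 6399, by norm_num [hs], by norm_num [hs], fun f hfm hf hf1 => ?_⟩
  obtain ⟨A, hA⟩ : ∃ A : ℂ → ℂ, A = fun w => ((1 - ‖w‖ ^ 2 : ℝ) : ℂ) * f w := ⟨_, rfl⟩
  have hAm : Measurable A := by rw [hA]; fun_prop
  have hAn : ∀ w ∈ disk, ‖A w‖ = blochDensity f w := fun w hw => by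
    rw [hA]; exact norm_ofReal_mul_eq_blochDensity f hw
  have hVm := (stronglyMeasurable_sweptDensity hfm).measurable
  have hIm : Measurable ((largeSet f).indicator A) := hAm.indicator (measurableSet_largeSet hfm)
  refine ⟨fun w => A w - s * (largeSet f).indicator A w + s * sweptDensity f w, by fun_prop,
    fun w hw => ?_, fun g M hg hM => ?_⟩
  · change ‖A w - s * (largeSet f).indicator A w + s * sweptDensity f w‖ ≤ 1 - s / 6399
    have ha := hAn w hw
    have ha1 := hf1 w hw
    have ha0 := blochDensity_nonneg f hw
    have hsn : ‖(s : ℂ)‖ = s := by rw [Complex.norm_real, Real.norm_of_nonneg (by norm_num [hs])]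
    have hsn' : ‖(1 - s : ℂ)‖ = 1 - s := by
      rw [← Complex.ofReal_one, ← Complex.ofReal_sub, Complex.norm_real,
        Real.norm_of_nonneg (by norm_num [hs])]
    rcases lt_or_ge (blochDensity f w) (1 - 1 / 19200) with h | h
    · have h1 : ‖A w - s * (largeSet f).indicator A w‖ ≤ blochDensity f w := by
        by_cases hl : w ∈ largeSet f
        · rw [Set.indicator_of_mem hl, ← one_sub_mul, norm_mul, hsn', ha]
          refine mul_le_of_le_one_left ha0 ?_
          norm_num [hs]
        · rw [Set.indicator_of_notMem hl, mul_zero, sub_zero, ha]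
      have h2 := norm_sweptDensity_le_const hf hf1 hw
      refine (norm_add_le _ _).trans ?_
      rw [norm_mul, hsn]
      have h3 : s * ‖sweptDensity f w‖ ≤ s * 64 := by
        gcongr
      have h4 : s * 64 = 1 / 38400 := by norm_num [hs]
      have h5 : s / 6399 ≤ 1 / 38400 := by norm_num [hs]
      linarith
    · have hl : w ∈ largeSet f := ⟨hw, by linarith⟩
      rw [Set.indicator_of_mem hl, ← one_sub_mul]
      refine (norm_add_le _ _).trans ?_
      rw [norm_mul, norm_mul, hsn, hsn', ha]
      have h2 := norm_sweptDensity_le hf1 hw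
      have h3 : (1 - 1 / 19200 : ℝ) ^ 3 ≤ blochDensity f w ^ 3 := by gcongr
      have h4 : (blochDensity f w ^ 3)⁻¹ ≤ 6400 / 6399 := by
        rw [inv_le_comm₀ (by positivity) (by norm_num)]
        exact le_trans (by norm_num) h3
      have h5 : ‖sweptDensity f w‖ ≤ 6398 / 6399 := by
        refine h2.trans ?_
        linarith
      have h6 : (1 - s) * blochDensity f w ≤ (1 - s) * 1 := by
        gcongr
        norm_num [hs]
      have h7 : s * ‖sweptDensity f w‖ ≤ s * (6398 / 6399) := by
        gcongr
      linarith
  · have hgm : AEStronglyMeasurable (fun w => (starRingEnd ℂ) (g w)) (volume.restrict disk) :=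
      Complex.continuous_conj.comp_aestronglyMeasurable
        (hg.continuousOn.aestronglyMeasurable measurableSet_ball)
    have hi : ∀ (h : ℂ → ℂ), Measurable h → (∀ w ∈ disk, ‖h w‖ ≤ 64) →
        IntegrableOn (fun w => h w * (starRingEnd ℂ) (g w)) disk := by
      intro h hh hb
      refine IntegrableOn.of_bound measure_ball_lt_top (hh.aestronglyMeasurable.mul hgm)
        (64 * M) ?_
      filter_upwards [ae_restrict_mem measurableSet_ball] with w hw
      rw [norm_mul, RCLike.norm_conj]
      exact mul_le_mul (hb w hw) (hM w hw) (norm_nonneg _) (by norm_num)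
    have hiA := hi A hAm fun w hw => by rw [hAn w hw]; linarith [hf1 w hw]
    have hiI := hi _ hIm fun w hw => by
      refine (norm_indicator_le_norm_self _ _).trans ?_
      rw [hAn w hw]; linarith [hf1 w hw]
    have hiV := hi _ hVm fun w hw => norm_sweptDensity_le_const hf hf1 hw
    have e : ∀ w, (A w - s * (largeSet f).indicator A w + s * sweptDensity f w)
        * (starRingEnd ℂ) (g w) = A w * (starRingEnd ℂ) (g w)
          - s * ((largeSet f).indicator A w * (starRingEnd ℂ) (g w))
          + s * (sweptDensity f w * (starRingEnd ℂ) (g w)) := fun w => by ring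
    have hiAI : IntegrableOn (fun w => A w * (starRingEnd ℂ) (g w)
        - s * ((largeSet f).indicator A w * (starRingEnd ℂ) (g w))) disk :=
      hiA.sub (hiI.const_mul _)
    simp only [e]
    rw [integral_add hiAI (hiV.const_mul _), integral_sub hiA (hiI.const_mul _),
      integral_const_mul, integral_const_mul,
      integral_sweptDensity_mul_conj hfm hf hf1 hg hM, hA]
    exact sub_add_cancel _ _

/-! ### Representation of Bloch functions -/

theorem blochQuotient_le_blochNorm (b : blochSpace) {z : ℂ} (hz : z ∈ disk) :
    blochQuotient (b : ℂ → ℂ) z ≤ blochNorm b :=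
  le_csSup b.2.2 ⟨z, hz, rfl⟩

theorem blochNorm_nonneg (b : blochSpace) : 0 ≤ blochNorm b := by
  have h0 : (0 : ℂ) ∈ disk := by simp
  exact (blochQuotient_nonneg _ h0).trans (blochQuotient_le_blochNorm b h0)

theorem norm_toLp_le {m : ℂ → ℂ} (hm : MemLp m ⊤ (volume.restrict disk)) {C : ℝ} (hC : 0 ≤ C)
    (h : ∀ᵐ w ∂volume.restrict disk, ‖m w‖ ≤ C) : ‖hm.toLp m‖ ≤ C := by
  rw [Lp.norm_toLp, eLpNorm_exponent_top]
  exact ENNReal.toReal_le_of_le_ofReal hC (eLpNormEssSup_le_of_ae_bound h)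

/-- The kernel integral of a bounded density supported in `|w| ≤ ρ < 1` is bounded on the disk. -/
theorem norm_setIntegral_kernel_le {m : ℂ → ℂ} {ρ C : ℝ} (hρ : ρ < 1)
    (hm : ∀ w ∈ disk, ‖m w‖ ≤ C) (hm0 : ∀ w, ρ < ‖w‖ → m w = 0) {z : ℂ} (hz : z ∈ disk) :
    ‖∫ w in disk, m w * (1 / (1 - z * (starRingEnd ℂ) w) ^ 3)‖
      ≤ C * (1 / (1 - ρ) ^ 3) * volume.real disk := by
  have hz' := mem_disk.1 hz
  have hρ' : 0 < 1 - ρ := by linarith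
  have h0 : 0 ≤ C := (norm_nonneg _).trans (hm 0 (by simp))
  refine norm_setIntegral_le_of_norm_le_const measure_ball_lt_top fun w hw => ?_
  rcases lt_or_ge ρ ‖w‖ with h | h
  · rw [hm0 w h, zero_mul, norm_zero]
    positivity
  · have h1 := one_sub_norm_le_norm_one_sub (z := w) hz'.le
    rw [norm_one_sub_conj_mul_comm, ← norm_one_sub_mul_conj] at h1
    rw [norm_mul, norm_div, norm_pow, norm_one]
    have h2 : 1 - ρ ≤ ‖1 - z * (starRingEnd ℂ) w‖ := by linarith
    have := hm w hw
    gcongr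

/-- Every Bloch function `b` is `Pμ` modulo the little Bloch space, with
`μ = ‖b‖_𝓑 ν / w̄` near the unit circle and `μ = 0` elsewhere; here `ν` is the density that
`exists_density_le_const_lt_one` provides for `b' / ‖b‖_𝓑`. -/
theorem exists_bergmanProj_sub_mem :
    ∃ C : ℝ, 0 ≤ C ∧ C < 1 ∧ ∀ b : blochSpace, ∃ μ : LInftyDisk, ‖μ‖ ≤ C * blochNorm b ∧
      b - ⟨bergmanProj μ, bergmanProj_mem_blochSpace μ⟩ ∈ littleBlochSpace := by
  obtain ⟨c, hc0, hc1, hc⟩ := exists_density_le_const_lt_one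
  -- Dividing by `w̄` on `|w| > ρ` costs a factor `1 / ρ`; `c / ρ < 1` holds since `c < ρ`.
  obtain ⟨ρ, hρ⟩ : ∃ ρ : ℝ, ρ = (1 + c) / 2 := ⟨_, rfl⟩
  have hρ0 : 0 < ρ := by linarith
  have hρ1 : ρ < 1 := by linarith
  refine ⟨c / ρ, by positivity, by rw [div_lt_one hρ0]; linarith, fun b => ?_⟩
  have hb := b.2.1
  have hN := blochNorm_nonneg b
  set N := blochNorm b with hNdef
  obtain ⟨f, hf⟩ : ∃ f : ℂ → ℂ, f = deriv (b : ℂ → ℂ) := ⟨_, rfl⟩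
  have hfd : DifferentiableOn ℂ f disk := by rw [hf]; exact hb.deriv Metric.isOpen_ball
  have hfm : Measurable f := by rw [hf]; exact measurable_deriv _
  have hfN : ∀ w ∈ disk, blochDensity f w ≤ N := fun w hw => by
    rw [hf]; exact blochQuotient_le_blochNorm b hw
  -- The normalized density has the factor `N⁻¹`, which vanishes when `N = 0`.
  obtain ⟨ν, hνm, hνb, hν⟩ := hc (fun w => (N⁻¹ : ℝ) * f w) (by fun_prop) (hfd.const_mul _) (by
    intro w hw
    have h1 : blochDensity (fun w => (N⁻¹ : ℝ) * f w) w = N⁻¹ * blochDensity f w := by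
      rw [blochDensity, blochDensity, norm_mul, Complex.norm_real,
        Real.norm_of_nonneg (inv_nonneg.2 hN)]
      ring
    rw [h1]
    exact inv_mul_le_one_of_le₀ (hfN w hw) hN)
  obtain ⟨m, hm⟩ : ∃ m : ℂ → ℂ, m = Set.indicator {w | ρ < ‖w‖}
    (fun w => N * ν w / (starRingEnd ℂ) w) := ⟨_, rfl⟩
  have hms : MeasurableSet {w : ℂ | ρ < ‖w‖} := measurableSet_lt measurable_const measurable_norm
  have hconj : Measurable (starRingEnd ℂ) := Complex.continuous_conj.measurable
  have hmm : Measurable m := by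
    rw [hm]
    exact Measurable.indicator (by fun_prop) hms
  have hmb : ∀ w ∈ disk, ‖m w‖ ≤ c / ρ * N := by
    intro w hw
    rw [hm]
    by_cases h : ρ < ‖w‖
    · rw [Set.indicator_of_mem (by exact h), norm_div, norm_mul, RCLike.norm_conj,
        Complex.norm_real, Real.norm_of_nonneg hN]
      calc N * ‖ν w‖ / ‖w‖ ≤ N * c / ρ := by
            have := hνb w hw
            gcongr
        _ = c / ρ * N := by ring
    · rw [Set.indicator_of_notMem (by exact h), norm_zero]
      positivity
  have hmae : ∀ᵐ w ∂volume.restrict disk, ‖m w‖ ≤ c / ρ * N := by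
    filter_upwards [ae_restrict_mem measurableSet_ball] with w hw using hmb w hw
  have hmL : MemLp m ⊤ (volume.restrict disk) :=
    memLp_top_of_bound hmm.aestronglyMeasurable _ hmae
  refine ⟨hmL.toLp m, norm_toLp_le hmL (by positivity) hmae, ?_⟩
  refine mem_littleBlochSpace_of_deriv_bounded
    (M := 2 / Real.pi * ((N * c) * (1 / (1 - ρ) ^ 3) * volume.real disk)) fun z hz => ?_
  have hz' := mem_disk.1 hz
  -- `N ν` has the same pairing with the kernel as `(1 - |w|²) b'(w)`, and so reproduces `b'`
  have hrep : ∫ w in disk, N * ν w * (1 / (1 - z * (starRingEnd ℂ) w) ^ 3)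
      = Real.pi / 2 * f z := by
    have h1 := hν (fun w => 1 / (1 - (starRingEnd ℂ) z * w) ^ 3) (1 / (1 - ‖z‖) ^ 3)
      (by
        refine DifferentiableOn.div (by fun_prop) (by fun_prop) fun w hw => ?_
        exact pow_ne_zero 3 (one_sub_conj_mul_ne_zero hz (mem_disk.1 hw).le))
      (by
        intro w hw
        have h2 := one_sub_norm_le_norm_one_sub (z := z) (mem_disk.1 hw).le
        have h3 : 0 < 1 - ‖z‖ := by linarith
        rw [norm_div, norm_pow, norm_one]
        gcongr)
    have h2 : ∀ w, (starRingEnd ℂ) (1 / (1 - (starRingEnd ℂ) z * w) ^ 3)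
        = 1 / (1 - z * (starRingEnd ℂ) w) ^ 3 := by
      intro w
      simp
    simp only [h2] at h1
    have h3 := setIntegral_reproducing hfd hfN hz
    simp only [mul_assoc]
    rw [integral_const_mul, h1]
    rcases hN.eq_or_lt with h0 | h0
    · have hfz : f z = 0 := by
        have h4 := hfN z hz
        rw [← h0, blochDensity] at h4
        have h5 := one_sub_sq_pos hz
        exact norm_le_zero_iff.1 (nonpos_of_mul_nonpos_right h4 h5)
      rw [hfz, ← h0]
      simp
    · rw [← integral_const_mul, ← h3]
      refine integral_congr_ae (ae_of_all _ fun w => ?_)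
      have hNc : (N : ℂ) ≠ 0 := by exact_mod_cast h0.ne'
      simp only
      rw [Complex.ofReal_inv]
      field_simp
  have hker : ∀ (h : ℂ → ℂ) (B : ℝ), Measurable h → (∀ w ∈ disk, ‖h w‖ ≤ B) →
      IntegrableOn (fun w => h w * (1 / (1 - z * (starRingEnd ℂ) w) ^ 3)) disk := by
    intro h B hh hB
    refine IntegrableOn.of_bound measure_ball_lt_top
      (by fun_prop : Measurable _).aestronglyMeasurable (B * (1 / (1 - ‖z‖) ^ 3)) ?_
    filter_upwards [ae_restrict_mem measurableSet_ball] with w hw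
    have h1 := norm_one_sub_mul_conj_ge (z := z) hw
    have h2 : 0 < 1 - ‖z‖ := by linarith
    have h3 := hB w hw
    have h4 := (norm_nonneg _).trans h3
    rw [norm_mul, norm_div, norm_pow, norm_one]
    gcongr
  have hνN : ∀ w ∈ disk, ‖N * ν w‖ ≤ N * c := by
    intro w hw
    rw [norm_mul, Complex.norm_real, Real.norm_of_nonneg hN]
    have := hνb w hw
    gcongr
  have hmc : ∀ w ∈ disk, ‖m w * (starRingEnd ℂ) w‖ ≤ c / ρ * N := by
    intro w hw
    rw [norm_mul, RCLike.norm_conj]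
    have h1 := (mem_disk.1 hw).le
    have h2 := hmb w hw
    nlinarith [norm_nonneg w, norm_nonneg (m w)]
  have hderiv : deriv ((b - ⟨bergmanProj (hmL.toLp m), bergmanProj_mem_blochSpace _⟩ : blochSpace) :
      ℂ → ℂ) z = 2 / Real.pi * ∫ w in disk, (N * ν w - m w * (starRingEnd ℂ) w)
        * (1 / (1 - z * (starRingEnd ℂ) w) ^ 3) := by
    have hbz : DifferentiableAt ℂ (b : ℂ → ℂ) z :=
      hb.differentiableAt (Metric.isOpen_ball.mem_nhds hz)
    have hP := hasDerivAt_bergmanProj (hmL.toLp m) hz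
    have h1 := (hbz.hasDerivAt.sub hP).deriv
    have h2 : ∫ w in disk, (hmL.toLp m : ℂ → ℂ) w * (starRingEnd ℂ) w
        * (1 / (1 - z * (starRingEnd ℂ) w) ^ 3)
        = ∫ w in disk, m w * (starRingEnd ℂ) w * (1 / (1 - z * (starRingEnd ℂ) w) ^ 3) := by
      refine integral_congr_ae ?_
      filter_upwards [hmL.coeFn_toLp] with w hw
      rw [hw]
    simp only [sub_mul]
    rw [integral_sub (hker _ _ (by fun_prop) hνN) (hker _ _ (by fun_prop) hmc), hrep, ← h2]
    refine h1.trans ?_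
    have hpi : (Real.pi : ℂ) ≠ 0 := by exact_mod_cast Real.pi_pos.ne'
    rw [← hf, mul_sub]
    congr 1
    field_simp
  rw [hderiv, norm_mul, norm_div, Complex.norm_real, Real.norm_of_nonneg Real.pi_pos.le,
    show ‖(2 : ℂ)‖ = 2 by simp]
  have hpi := Real.pi_pos
  gcongr
  have heq : ∀ w, ρ < ‖w‖ → N * ν w - m w * (starRingEnd ℂ) w = 0 := by
    intro w h
    have h1 : (starRingEnd ℂ) w ≠ 0 := (map_ne_zero _).2 (norm_pos_iff.1 (hρ0.trans h))
    rw [hm, Set.indicator_of_mem (by exact h), div_mul_cancel₀ _ h1, sub_self]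
  refine norm_setIntegral_kernel_le hρ1 (fun w hw => ?_) heq hz
  by_cases h : ρ < ‖w‖
  · rw [heq w h, norm_zero]
    positivity
  · rw [hm, Set.indicator_of_notMem (by exact h), zero_mul, sub_zero]
    exact hνN w hw

end

/-- The Bergman projection induces a well-defined linear map `L^∞(𝔻) → 𝓑/𝓑₀`, which is
surjective; some constant `C` is admissible in `b = Pμ + b₀`, `‖μ‖_∞ ≤ C ‖b‖_𝓑`; and the optimal constant
(that is, the infimum of all admissible ones) is strictly less than `1`. -/
theorem lemma2p1 :
    (∃ T : LInftyDisk →ₗ[ℂ] blochSpace ⧸ littleBlochSpace,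
      (∀ μ : LInftyDisk, ∃ h : bergmanProj μ ∈ blochSpace,
        T μ = littleBlochSpace.mkQ ⟨bergmanProj μ, h⟩) ∧
      Function.Surjective T) ∧
    (∃ C : ℝ, IsAdmissibleConstant C) ∧
    sInf {C : ℝ | IsAdmissibleConstant C} < 1 := by
  obtain ⟨C, hC0, hC1, hC⟩ := exists_bergmanProj_sub_mem
  have hadm : IsAdmissibleConstant C := by
    refine ⟨hC0, fun b => ?_⟩
    obtain ⟨μ, hμ, hb⟩ := hC b
    exact ⟨μ, _, hb, fun z _ => by simp, hμ⟩
  refine ⟨⟨bergmanProjQuot, fun μ => ⟨bergmanProj_mem_blochSpace μ, rfl⟩, fun y => ?_⟩,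
    ⟨C, hadm⟩, csInf_lt_of_lt ⟨0, fun _ h => h.1⟩ hadm hC1⟩
  obtain ⟨b, rfl⟩ := littleBlochSpace.mkQ_surjective y
  obtain ⟨μ, _, hb⟩ := hC b
  exact ⟨μ, ((Submodule.Quotient.eq _).2 hb).symm⟩
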